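/- Notation. $B_R\subset\mathbb{R}^3$ is the open ball of radius $R$ centred at the origin, and for a vector field $u:\mathbb{R}^3\to\mathbb{R}^3$ and $x\ne 0$ the normal and tangential parts are $$u_N=\Big(u\cdot\frac{x}{|x|}\Big)\frac{x}{|x|},\qquad u_T=u-u_N=\frac{x}{|x|}\times\Big(u\times\frac{x}{|x|}\Big).$$ Theorem. Let $u\in W^{1,3/2}_{\mathrm{loc}}(\mathbb{R}^3,\mathbb{R}^3)$ be a weak Beltrami flow, i.e. its weak derivatives satisfy $\operatorname{curl}u\times u=0$ and $\operatorname{div}u=0$ almost everywhere in $\mathbb{R}^3$. Suppose that one of the following conditions holds: (a) for some $p\in[2,3]$, $$\lim_{R\to+\infty}\frac{1}{R^{3-p}}\int_{B_{2R}\setminus\overline{B_R}}|u_T|^p\,dx=0;$$ (b) $$\lim_{R\to+\infty}\frac{1}{\ln R}\int_{B_R\setminus\overline{B_1}}\frac{|u_T|^2}{|x|}\,dx=0;$$ (c) for some $\beta\in(-\infty,1)$, $$\lim_{R\to+\infty}\frac{1}{(\ln R)^{1-\beta}}\int_{B_R\setminus\overline{B_e}}\frac{|u_T|^2}{|x|(\ln|x|)^{\beta}}\,dx=0;$$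 (d) $$\lim_{R\to+\infty}\frac{1}{\ln\ln R}\int_{B_R\setminus\overline{B_e}}\frac{|u_T|^2}{|x|\ln|x|}\,dx=0.$$ Then $u=0$ almost everywhere in $\mathbb{R}^3$. -/

import Mathlib

open MeasureTheory Filter Topology Set
open scoped ENNReal ContDiff Matrix

namespace Beltrami

/-- Three dimensional Euclidean space. -/
abbrev E3 : Type := EuclideanSpace ℝ (Fin 3)

/-- `f` belongs to `L^p` on every compact set. -/
def MemLpLoc (p : ℝ≥0∞) {F : Type*} [NormedAddCommGroup F] (f : E3 → F) : Prop :=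
  ∀ K : Set E3, IsCompact K → MemLp f p (volume.restrict K)

/-- `g` is the weak partial derivative `∂_j f` of the locally integrable function `f` on `ℝ³`:
`∫ f ∂_j φ = - ∫ g φ` for all real-valued smooth compactly supported `φ`. -/
def HasWeakPartialDeriv (j : Fin 3) (f g : E3 → ℝ) : Prop :=
  LocallyIntegrable f volume ∧ LocallyIntegrable g volume ∧
    ∀ φ : E3 → ℝ, ContDiff ℝ ∞ φ → HasCompactSupport φ →
      ∫ x, f x * fderiv ℝ φ x (EuclideanSpace.single j 1) = - ∫ x, g x * φ x

/-- The vector field `u` belongs to `W^{1,p}_loc(ℝ³, ℝ³)`, with weak Jacobian matrix `J`, that is,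
`J x i j = ∂_j u_i (x)`. -/
structure IsW1pLocWithJacobian (p : ℝ≥0∞) (u : E3 → E3)
    (J : E3 → Matrix (Fin 3) (Fin 3) ℝ) : Prop where
  memLpLoc : MemLpLoc p u
  memLpLoc_jacobian : ∀ i j, MemLpLoc p (fun x => J x i j)
  weakDeriv : ∀ i j, HasWeakPartialDeriv j (fun x => u x i) (fun x => J x i j)

/-- The curl of a vector field at a point, read off from its Jacobian matrix `A i j = ∂_j u_i`. -/
def curlOfJacobian (A : Matrix (Fin 3) (Fin 3) ℝ) : Fin 3 → ℝ :=
  ![A 2 1 - A 1 2, A 0 2 - A 2 0, A 1 0 - A 0 1]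

/-- The divergence of a vector field at a point, read off from its Jacobian matrix. -/
def divOfJacobian (A : Matrix (Fin 3) (Fin 3) ℝ) : ℝ := ∑ i, A i i

/-- Weak Beltrami flows: `u ∈ W^{1,3/2}_loc(ℝ³, ℝ³)` with `curl u × u = 0` and `div u = 0` almost
everywhere. (The weak Jacobian `J` is determined by `u` almost everywhere.) -/
def IsWeakBeltramiFlow (u : E3 → E3) : Prop :=
  ∃ J : E3 → Matrix (Fin 3) (Fin 3) ℝ, IsW1pLocWithJacobian (3 / 2) u J ∧
    ∀ᵐ x ∂(volume : Measure E3),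
      crossProduct (curlOfJacobian (J x)) (u x).ofLp = 0 ∧ divOfJacobian (J x) = 0

/-- The normal part `u_N = (u · x/|x|) x/|x|`. -/
noncomputable def normalPart (u : E3 → E3) (x : E3) : E3 :=
  inner ℝ (u x) (‖x‖⁻¹ • x) • (‖x‖⁻¹ • x)

/-- The tangential part `u_T = u - u_N`. -/
noncomputable def tangentialPart (u : E3 → E3) (x : E3) : E3 :=
  u x - normalPart u x

/-- The open annulus `B_R \ closure B_r` centred at the origin. -/
def annulus (r R : ℝ) : Set E3 := Metric.ball 0 R \ Metric.closedBall 0 r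

end Beltrami

namespace Beltrami

open scoped Convolution NNReal
open ContinuousLinearMap (lsmul)

/-! The proof is a virial argument. Since `(div u) u + curl u × u` is the divergence of the stress
tensor `T = u ⊗ u - |u|² I / 2`, a Beltrami flow satisfies `∫ T : ∇Φ = 0` for every test field `Φ`
(`integral_stress_eq_zero`). At the regularity `W^{1,3/2}_loc` this rests on the Sobolev embedding
into `L³_loc`: the exponents `3` and `3/2` are conjugate, so `u ∂u` is locally integrable and the
product rule survives mollification.

Take `Φ = η w x` with `w = (1 + |x|²)^{-1/2}`, a smooth substitute for `x/|x|`, and `η` a radially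
nonincreasing cutoff. In `2 T : ∇Φ` the terms containing `u · x` have a favourable sign, the
derivative of `w` yields `-η w³ |u|²`, and what remains is at most `|∇η| |u_T|²`. Hence `∫ η w³ |u|²
≤ ∫ |∇η| |u_T|²` (`lintegral_weight_le`): the tangential part in the transition region of the cutoff
controls all of `u` inside.

For an increasing `L` tending to infinity, let `η` fall from 1 to 0 as `L(|x|)/L(R)` goes from 1/2
to 1. Then `|∇η| ≤ C L'(|x|)/L(R)`, and `u` vanishes as soon as the corresponding average of
`|u_T|²` tends to zero (`ae_eq_zero_of_tendsto`). The four conditions correspond to `L = r`, `log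
r`, `(log r)^{1-β}` and `log log r`; in the first, exponents `p > 2` are reduced to `p = 2` by
splitting at a small multiple of `1/R`. -/

/-! ### Mollification in `L^p` and of weak derivatives -/

/-- A sequence of bump functions at the origin with radii tending to zero. -/
noncomputable def bumpSeq (n : ℕ) : ContDiffBump (0 : E3) where
  rIn := 1 / (2 * ((n : ℝ) + 1))
  rOut := 1 / ((n : ℝ) + 1)
  rIn_pos := by positivity
  rIn_lt_rOut := by
    apply one_div_lt_one_div_of_lt <;> [positivity; linarith [n.cast_nonneg (α := ℝ)]]

lemma tendsto_bumpSeq_rOut : Tendsto (fun n => (bumpSeq n).rOut) atTop (𝓝 0) :=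
  tendsto_one_div_add_atTop_nhds_zero_nat

/-- Mollification of a real function at scale `1 / (n + 1)`. -/
noncomputable def mollify (n : ℕ) (f : E3 → ℝ) : E3 → ℝ :=
  (bumpSeq n).normed volume ⋆[lsmul ℝ ℝ, volume] f

lemma mollify_apply (n : ℕ) (f : E3 → ℝ) (x : E3) :
    mollify n f x = ∫ t, (bumpSeq n).normed volume t * f (x - t) := rfl

lemma contDiff_mollify (n : ℕ) {f : E3 → ℝ} (hf : LocallyIntegrable f volume) :
    ContDiff ℝ ∞ (mollify n f) :=
  HasCompactSupport.contDiff_convolution_left _ (bumpSeq n).hasCompactSupport_normed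
    (bumpSeq n).contDiff_normed hf

lemma hasCompactSupport_mollify (n : ℕ) {f : E3 → ℝ} (hf : HasCompactSupport f) :
    HasCompactSupport (mollify n f) :=
  HasCompactSupport.convolution _ (bumpSeq n).hasCompactSupport_normed hf

lemma ae_tendsto_mollify {f : E3 → ℝ} (hf : LocallyIntegrable f volume) :
    ∀ᵐ x, Tendsto (fun n => mollify n f x) atTop (𝓝 (f x)) := by
  -- Almost everywhere convergence needs a bounded ratio of outer to inner radius; here it is
  -- exactly 2.
  refine ContDiffBump.ae_convolution_tendsto_right_of_locallyIntegrable (K := 2)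
    tendsto_bumpSeq_rOut (Eventually.of_forall fun n => ?_) hf
  simp only [bumpSeq]
  apply le_of_eq
  field_simp

/-- The probability measure with density the normed bump function. -/
noncomputable def bumpMeasure (n : ℕ) : Measure E3 :=
  volume.withDensity fun t => ENNReal.ofReal ((bumpSeq n).normed volume t)

lemma measurable_ofReal_bump (n : ℕ) :
    Measurable fun t => ENNReal.ofReal ((bumpSeq n).normed volume t) :=
  (ENNReal.continuous_ofReal.comp (bumpSeq n).continuous_normed).measurable

instance isProbabilityMeasure_bumpMeasure (n : ℕ) : IsProbabilityMeasure (bumpMeasure n) where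
  measure_univ := by
    rw [bumpMeasure, withDensity_apply _ MeasurableSet.univ, Measure.restrict_univ,
      ← ofReal_integral_eq_lintegral_ofReal (bumpSeq n).integrable_normed
        (Eventually.of_forall (bumpSeq n).nonneg_normed), (bumpSeq n).integral_normed,
      ENNReal.ofReal_one]

lemma enorm_mollify_le (n : ℕ) (f : E3 → ℝ) (x : E3)
    (hf : AEStronglyMeasurable f volume) :
    ‖mollify n f x‖ₑ ≤ ∫⁻ t, ‖f (x - t)‖ₑ ∂(bumpMeasure n) := by
  have hm : AEMeasurable (fun t => ‖f (x - t)‖ₑ) volume :=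
    (hf.comp_quasiMeasurePreserving
      (quasiMeasurePreserving_sub_left_of_right_invariant volume x)).enorm
  rw [bumpMeasure, lintegral_withDensity_eq_lintegral_mul₀
    (measurable_ofReal_bump n).aemeasurable hm, mollify_apply]
  refine (enorm_integral_le_lintegral_enorm _).trans (lintegral_mono fun t => ?_)
  simp only [enorm_mul, Pi.mul_apply]
  rw [Real.enorm_of_nonneg ((bumpSeq n).nonneg_normed t)]

/-- Mollification does not increase `L^p` norms. -/
theorem eLpNorm_mollify_le (n : ℕ) {f : E3 → ℝ} (hf : AEStronglyMeasurable f volume)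
    {p : ℝ≥0∞} (hp : 1 ≤ p) (hp' : p ≠ ⊤) :
    eLpNorm (mollify n f) p volume ≤ eLpNorm f p volume := by
  have hp0 : p ≠ 0 := (zero_lt_one.trans_le hp).ne'
  have hpr : 0 < p.toReal := ENNReal.toReal_pos hp0 hp'
  have hac : bumpMeasure n ≪ volume := withDensity_absolutelyContinuous _ _
  have key : ∀ x, ‖mollify n f x‖ₑ ^ p.toReal ≤ ∫⁻ t, ‖f (x - t)‖ₑ ^ p.toReal ∂(bumpMeasure n) := by
    intro x
    have hm : AEStronglyMeasurable (fun t => f (x - t)) (bumpMeasure n) :=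
      (hf.comp_quasiMeasurePreserving
        (quasiMeasurePreserving_sub_left_of_right_invariant volume x)).mono_ac hac
    have h1 := enorm_mollify_le n f x hf
    -- Jensen's inequality: on a probability space the `L¹` norm is at most the `L^p` norm. Tonelli
    -- and translation invariance then finish.
    have h2 := eLpNorm_le_eLpNorm_of_exponent_le hp hm
    rw [eLpNorm_one_eq_lintegral_enorm, eLpNorm_eq_lintegral_rpow_enorm_toReal hp0 hp'] at h2
    calc ‖mollify n f x‖ₑ ^ p.toReal ≤ _ := ENNReal.rpow_le_rpow (h1.trans h2) hpr.le
      _ = _ := by rw [← ENNReal.rpow_mul, one_div, inv_mul_cancel₀ hpr.ne', ENNReal.rpow_one]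
  rw [eLpNorm_eq_lintegral_rpow_enorm_toReal hp0 hp',
    eLpNorm_eq_lintegral_rpow_enorm_toReal hp0 hp']
  refine ENNReal.rpow_le_rpow ?_ (by positivity)
  have hmeas : AEMeasurable (Function.uncurry fun x t : E3 => ‖f (x - t)‖ₑ ^ p.toReal)
      (volume.prod (bumpMeasure n)) := by
    have : AEStronglyMeasurable (fun z : E3 × E3 => f (z.1 - z.2)) (volume.prod (bumpMeasure n)) :=
      (hf.comp_quasiMeasurePreserving
        (quasiMeasurePreserving_sub_of_right_invariant volume volume)).mono_ac
        (Measure.AbsolutelyContinuous.rfl.prod hac)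
    exact this.enorm.pow_const _
  calc ∫⁻ x, ‖mollify n f x‖ₑ ^ p.toReal
      ≤ ∫⁻ x, (∫⁻ t, ‖f (x - t)‖ₑ ^ p.toReal ∂(bumpMeasure n)) ∂volume := lintegral_mono key
    _ = ∫⁻ t, (∫⁻ x, ‖f (x - t)‖ₑ ^ p.toReal ∂volume) ∂(bumpMeasure n) :=
        lintegral_lintegral_swap hmeas
    _ = ∫⁻ t, (∫⁻ x, ‖f x‖ₑ ^ p.toReal ∂volume) ∂(bumpMeasure n) := by
        congr 1; ext t
        exact lintegral_sub_right_eq_self (fun x => ‖f x‖ₑ ^ p.toReal) t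
    _ = ∫⁻ x, ‖f x‖ₑ ^ p.toReal := by simp

lemma mollify_sub (n : ℕ) {f g : E3 → ℝ} (hf : LocallyIntegrable f volume)
    (hg : LocallyIntegrable g volume) : mollify n (f - g) = mollify n f - mollify n g := by
  have key : ∀ (h : E3 → ℝ), LocallyIntegrable h volume → ∀ x,
      Integrable (fun t => (bumpSeq n).normed volume t * h (x - t)) volume := fun h hh x =>
    (bumpSeq n).hasCompactSupport_normed.convolutionExists_left (lsmul ℝ ℝ)
      (bumpSeq n).continuous_normed hh x
  ext x
  simp only [mollify_apply, Pi.sub_apply, mul_sub]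
  exact integral_sub (key f hf x) (key g hg x)

/-- Uniform continuity makes the convergence uniform, and since the radii are at most 1 every
difference lives on one compact neighbourhood of the support, so uniform smallness passes to `L^p`.
-/
lemma tendsto_eLpNorm_mollify_sub_of_continuous {g : E3 → ℝ} (hg : Continuous g)
    (hgs : HasCompactSupport g) {p : ℝ≥0∞} :
    Tendsto (fun n => eLpNorm (mollify n g - g) p volume) atTop (𝓝 0) := by
  set K : Set E3 := Metric.cthickening 1 (tsupport g) with hK
  have hKc : IsCompact K := hgs.isCompact.cthickening
  have hsupp : ∀ n x, x ∉ K → mollify n g x = 0 := by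
    intro n x hx
    rw [mollify_apply]
    refine integral_eq_zero_of_ae (Eventually.of_forall fun t => ?_)
    by_cases ht : t ∈ Metric.ball (0 : E3) (bumpSeq n).rOut
    · have : x - t ∉ tsupport g := fun h => hx (by
        refine Metric.mem_cthickening_of_dist_le x (x - t) 1 _ h ?_
        rw [dist_eq_norm, sub_sub_cancel]
        have h1 : ‖t‖ < (bumpSeq n).rOut := by simpa using ht
        have h2 : (bumpSeq n).rOut ≤ 1 := by
          simp only [bumpSeq]
          rw [div_le_one (by positivity)]
          linarith [n.cast_nonneg (α := ℝ)]
        linarith)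
      simp [image_eq_zero_of_notMem_tsupport this]
    · have : (bumpSeq n).normed volume t = 0 := by
        rw [← Function.notMem_support, ContDiffBump.support_normed_eq]; exact ht
      simp [this]
  have hunif := hgs.uniformContinuous_of_continuous hg
  rw [Metric.uniformContinuous_iff] at hunif
  set V : ℝ≥0∞ := (volume K) ^ p.toReal⁻¹ with hV
  have hVt : V ≠ ⊤ :=
    ENNReal.rpow_ne_top_of_nonneg (inv_nonneg.2 ENNReal.toReal_nonneg) hKc.measure_lt_top.ne
  have bound : ∀ δ : ℝ, 0 < δ → ∀ᶠ n in atTop,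
      eLpNorm (mollify n g - g) p volume ≤ V * ENNReal.ofReal δ := by
    intro δ hδ
    obtain ⟨ε, hε, hu⟩ := hunif δ hδ
    filter_upwards [tendsto_bumpSeq_rOut.eventually (gt_mem_nhds hε)] with n hn
    have h1 : ∀ x, ‖(mollify n g - g) x‖ ≤ δ := by
      intro x
      rw [Pi.sub_apply, ← dist_eq_norm]
      refine ContDiffBump.dist_normed_convolution_le hg.aestronglyMeasurable fun y hy => ?_
      exact (hu ((Metric.mem_ball.1 hy).trans hn)).le
    have h2 : mollify n g - g = K.indicator (mollify n g - g) := by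
      symm
      rw [indicator_eq_self]
      intro x hx
      by_contra hxK
      refine hx ?_
      have : x ∉ tsupport g := fun h => hxK (Metric.self_subset_cthickening _ h)
      simp [hsupp n x hxK, image_eq_zero_of_notMem_tsupport this]
    rw [h2, eLpNorm_indicator_eq_eLpNorm_restrict hKc.isClosed.measurableSet]
    refine (eLpNorm_le_of_ae_bound (Eventually.of_forall h1)).trans ?_
    rw [Measure.restrict_apply_univ]
  rw [ENNReal.tendsto_nhds_zero]
  intro ε hε
  have : Tendsto (fun δ : ℝ => V * ENNReal.ofReal δ) (𝓝[>] 0) (𝓝 (V * ENNReal.ofReal 0)) :=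
    ENNReal.Tendsto.const_mul ((ENNReal.continuous_ofReal.tendsto 0).mono_left nhdsWithin_le_nhds)
      (Or.inr hVt)
  rw [ENNReal.ofReal_zero, mul_zero] at this
  obtain ⟨δ, hδ, hδ'⟩ := ((this.eventually (gt_mem_nhds hε)).and self_mem_nhdsWithin).exists
  filter_upwards [bound δ hδ'] with n hn
  exact hn.trans hδ.le

/-- Mollifications converge in `L^p`. -/
theorem tendsto_eLpNorm_mollify_sub {f : E3 → ℝ} {p : ℝ≥0∞} (hp : 1 ≤ p) (hp' : p ≠ ⊤)
    (hf : MemLp f p volume) :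
    Tendsto (fun n => eLpNorm (mollify n f - f) p volume) atTop (𝓝 0) := by
  rw [ENNReal.tendsto_nhds_zero]
  intro ε hε
  have hε3 : ε / 3 ≠ 0 := (ENNReal.div_pos hε.ne' (by norm_num)).ne'
  -- Density of continuous compactly supported functions; the contraction property controls the
  -- mollified error.
  obtain ⟨g, hgs, hfg, hgc, hgm⟩ := hf.exists_hasCompactSupport_eLpNorm_sub_le hp' hε3
  have hfl := hf.locallyIntegrable hp
  have hgl := hgm.locallyIntegrable hp
  filter_upwards [ENNReal.tendsto_nhds_zero.1
    (tendsto_eLpNorm_mollify_sub_of_continuous (p := p) hgc hgs) (ε / 3) hε3.bot_lt] with n hn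
  have e : mollify n f - f = (mollify n (f - g) + (mollify n g - g)) - (f - g) := by
    rw [mollify_sub n hfl hgl]; abel
  have m1 : AEStronglyMeasurable (mollify n (f - g)) volume :=
    (contDiff_mollify n (hfl.sub hgl)).continuous.aestronglyMeasurable
  have m2 : AEStronglyMeasurable (mollify n g - g) volume :=
    ((contDiff_mollify n hgl).continuous.sub hgc).aestronglyMeasurable
  have m3 : AEStronglyMeasurable (f - g) volume := (hf.sub hgm).1
  rw [e]
  calc _ ≤ eLpNorm (mollify n (f - g) + (mollify n g - g)) p volume + eLpNorm (f - g) p volume :=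
        eLpNorm_sub_le (m1.add m2) m3 hp
    _ ≤ (eLpNorm (mollify n (f - g)) p volume + eLpNorm (mollify n g - g) p volume)
          + eLpNorm (f - g) p volume := by
        gcongr; exact eLpNorm_add_le m1 m2 hp
    _ ≤ (ε / 3 + ε / 3) + ε / 3 := by
        gcongr
        exact (eLpNorm_mollify_le n m3 hp hp').trans hfg
    _ = ε := ENNReal.add_thirds ε

/-- The derivative falls on the kernel, and `y ↦ ρ (x - y)` is itself a test function; the sign from
the reflection cancels the one in the weak derivative. -/
lemma fderiv_convolution_apply_of_hasWeakPartialDeriv {ρ : E3 → ℝ} (hρd : ContDiff ℝ ∞ ρ)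
    (hρs : HasCompactSupport ρ) {j : Fin 3} {f g : E3 → ℝ} (h : HasWeakPartialDeriv j f g)
    (x : E3) :
    fderiv ℝ (ρ ⋆[lsmul ℝ ℝ, volume] f) x (EuclideanSpace.single j 1) =
      (ρ ⋆[lsmul ℝ ℝ, volume] g) x := by
  have hφd : ContDiff ℝ ∞ fun y => ρ (x - y) := hρd.comp (contDiff_const.sub contDiff_id)
  have hφs : HasCompactSupport fun y => ρ (x - y) :=
    hρs.comp_homeomorph (Homeomorph.subLeft x)
  have hw := h.2.2 _ hφd hφs
  have hder : ∀ y v, fderiv ℝ (fun y => ρ (x - y)) y v = - fderiv ℝ ρ (x - y) v := by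
    intro y v
    have h1 : HasFDerivAt ρ (fderiv ℝ ρ (x - y)) (x - y) :=
      (hρd.differentiable (by simp)).differentiableAt.hasFDerivAt
    have h2 := h1.comp y ((hasFDerivAt_id y).const_sub x)
    have h3 : HasFDerivAt (fun y => ρ (x - y))
        ((fderiv ℝ ρ (x - y)).comp (-ContinuousLinearMap.id ℝ E3)) y := h2
    rw [h3.fderiv]
    simp
  simp only [hder, mul_neg, integral_neg, neg_inj] at hw
  simp only [mul_comm (f _), mul_comm (g _)] at hw
  rw [← convolution_flip (f := ρ) (g := f), ← convolution_flip (f := ρ) (g := g),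
    (hρs.hasFDerivAt_convolution_right
    (lsmul ℝ ℝ).flip h.1 (hρd.of_le (by simp)) x).fderiv, convolution_precompR_apply _ h.1
    (hρs.fderiv (𝕜 := ℝ)) (hρd.continuous_fderiv (by simp))]
  exact hw

/-- Mollification commutes with weak derivatives. -/
theorem fderiv_mollify_apply (n : ℕ) {j : Fin 3} {f g : E3 → ℝ} (h : HasWeakPartialDeriv j f g)
    (x : E3) :
    fderiv ℝ (mollify n f) x (EuclideanSpace.single j 1) = mollify n g x :=
  fderiv_convolution_apply_of_hasWeakPartialDeriv (bumpSeq n).contDiff_normed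
    (bumpSeq n).hasCompactSupport_normed h x

/-! ### Local Sobolev embedding and the product rule -/

instance holderTriple_three_threeHalves : ENNReal.HolderTriple 3 (3 / 2) 1 where
  inv_add_inv_eq_inv := by
    rw [ENNReal.inv_div (by simp) (by simp), ← one_div, ← ENNReal.add_div, inv_one]
    norm_num
    exact ENNReal.div_self (by simp) (by simp)

instance holderTriple_threeHalves_three : ENNReal.HolderTriple (3 / 2) 3 1 :=
  ENNReal.HolderTriple.symm

lemma one_le_threeHalves : (1 : ℝ≥0∞) ≤ 3 / 2 := by
  rw [ENNReal.le_div_iff_mul_le (by simp) (by simp)]; norm_num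

lemma threeHalves_ne_top : (3 / 2 : ℝ≥0∞) ≠ ⊤ := ENNReal.div_ne_top (by simp) (by simp)

lemma MemLpLoc.mul_left {p : ℝ≥0∞} {f χ : E3 → ℝ} (hf : MemLpLoc p f) (hχ : Continuous χ)
    (hχs : HasCompactSupport χ) : MemLp (fun x => χ x * f x) p volume := by
  have h1 : MemLp (fun x => χ x * f x) p (volume.restrict (tsupport χ)) := by
    have hb : MemLp χ ⊤ (volume.restrict (tsupport χ)) :=
      (hχ.memLp_top_of_hasCompactSupport hχs _)
    exact MemLp.mul (hf _ hχs) hb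
  have h2 : (fun x => χ x * f x) = (tsupport χ).indicator fun x => χ x * f x := by
    symm
    rw [indicator_eq_self]
    intro x hx
    exact subset_tsupport _ (left_ne_zero_of_mul hx)
  rw [h2]
  exact (memLp_indicator_iff_restrict (isClosed_tsupport χ).measurableSet).2 h1

lemma MemLpLoc.locallyIntegrable {p : ℝ≥0∞} (hp : 1 ≤ p) {f : E3 → ℝ} (hf : MemLpLoc p f) :
    LocallyIntegrable f volume := by
  rw [locallyIntegrable_iff]
  intro K hK
  have : IsFiniteMeasure (volume.restrict K) := ⟨by simpa using hK.measure_lt_top⟩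
  exact (hf K hK).integrable hp

lemma LocallyIntegrable.integrable_mul_of_hasCompactSupport {f φ : E3 → ℝ}
    (hf : LocallyIntegrable f volume) (hφ : Continuous φ) (hφs : HasCompactSupport φ) :
    Integrable (fun x => f x * φ x) volume := by
  simpa [mul_comm] using hf.integrable_smul_left_of_hasCompactSupport hφ hφs

/-- Product rule for a weak derivative and a smooth compactly supported factor. -/
theorem HasWeakPartialDeriv.mul_left {j : Fin 3} {f g χ : E3 → ℝ} (h : HasWeakPartialDeriv j f g)
    (hχ : ContDiff ℝ ∞ χ) (hχs : HasCompactSupport χ) :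
    HasWeakPartialDeriv j (fun x => χ x * f x)
      (fun x => χ x * g x + fderiv ℝ χ x (EuclideanSpace.single j 1) * f x) := by
  obtain ⟨hf, hg, hw⟩ := h
  have hdc : ∀ ψ : E3 → ℝ, ContDiff ℝ ∞ ψ →
      Continuous fun x => fderiv ℝ ψ x (EuclideanSpace.single j 1) := fun ψ hψ =>
    (hψ.continuous_fderiv (by simp)).clm_apply continuous_const
  have hds : ∀ ψ : E3 → ℝ, HasCompactSupport ψ →
      HasCompactSupport fun x => fderiv ℝ ψ x (EuclideanSpace.single j 1) := fun ψ hψ =>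
    hψ.fderiv_apply (𝕜 := ℝ) _
  have i1 : Integrable (fun x => χ x * f x) volume := by
    simpa [mul_comm] using
      LocallyIntegrable.integrable_mul_of_hasCompactSupport hf hχ.continuous hχs
  have i2 : Integrable (fun x => χ x * g x) volume := by
    simpa [mul_comm] using
      LocallyIntegrable.integrable_mul_of_hasCompactSupport hg hχ.continuous hχs
  have i3 : Integrable (fun x => fderiv ℝ χ x (EuclideanSpace.single j 1) * f x) volume := by
    simpa [mul_comm] using
      LocallyIntegrable.integrable_mul_of_hasCompactSupport hf (hdc χ hχ) (hds χ hχs)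
  refine ⟨i1.locallyIntegrable, (i2.add i3).locallyIntegrable, fun φ hφ hφs => ?_⟩
  have hp := hw (fun x => χ x * φ x) (hχ.mul hφ) hφs.mul_left
  have hder : ∀ x v, fderiv ℝ (fun x => χ x * φ x) x v =
      χ x * fderiv ℝ φ x v + φ x * fderiv ℝ χ x v := by
    intro x v
    rw [fderiv_fun_mul (hχ.differentiable (by simp)).differentiableAt
      (hφ.differentiable (by simp)).differentiableAt]
    simp
  simp only [hder, mul_add] at hp
  have j1 : Integrable (fun x => f x * (χ x * fderiv ℝ φ x (EuclideanSpace.single j 1))) volume :=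
    LocallyIntegrable.integrable_mul_of_hasCompactSupport hf (hχ.continuous.mul (hdc φ hφ))
      hχs.mul_right
  have j2 : Integrable (fun x => f x * (φ x * fderiv ℝ χ x (EuclideanSpace.single j 1))) volume :=
    LocallyIntegrable.integrable_mul_of_hasCompactSupport hf (hφ.continuous.mul (hdc χ hχ))
      hφs.mul_right
  have j3 : Integrable (fun x => g x * (χ x * φ x)) volume :=
    LocallyIntegrable.integrable_mul_of_hasCompactSupport hg (hχ.continuous.mul hφ.continuous)
      hχs.mul_right
  rw [integral_add j1 j2] at hp
  have e1 : ∫ x, χ x * f x * fderiv ℝ φ x (EuclideanSpace.single j 1) =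
      ∫ x, f x * (χ x * fderiv ℝ φ x (EuclideanSpace.single j 1)) := by
    congr 1; ext x; ring
  have e2 : ∫ x, (χ x * g x + fderiv ℝ χ x (EuclideanSpace.single j 1) * f x) * φ x =
      (∫ x, g x * (χ x * φ x)) + ∫ x, f x * (φ x * fderiv ℝ χ x (EuclideanSpace.single j 1)) := by
    rw [← integral_add j3 j2]
    congr 1; ext x; ring
  rw [e1, e2]
  linarith

lemma norm_le_sum_apply_single (A : E3 →L[ℝ] ℝ) :
    ‖A‖ ≤ ‖A (EuclideanSpace.single 0 1)‖ + ‖A (EuclideanSpace.single 1 1)‖ +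
      ‖A (EuclideanSpace.single 2 1)‖ := by
  refine A.opNorm_le_bound (by positivity) fun x => ?_
  have hx : x = ∑ i, x i • EuclideanSpace.single i (1 : ℝ) := by
    ext k
    simp [Finset.sum_apply, Pi.single_apply]
  have hb : ∀ i, ‖x i‖ ≤ ‖x‖ := fun i => PiLp.norm_apply_le x i
  calc ‖A x‖ = ‖∑ i, x i * A (EuclideanSpace.single i (1 : ℝ))‖ := by
        conv_lhs => rw [hx]
        simp
    _ ≤ ∑ i, ‖x i * A (EuclideanSpace.single i (1 : ℝ))‖ := norm_sum_le _ _
    _ ≤ ∑ i, ‖x‖ * ‖A (EuclideanSpace.single i (1 : ℝ))‖ := by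
        gcongr with i
        rw [norm_mul]
        gcongr
        exact hb i
    _ = _ := by rw [Fin.sum_univ_three]; ring

/-- Sobolev embedding `W^{1,3/2} ⊆ L^3` for compactly supported functions. -/
theorem memLp_three_of_hasWeakPartialDeriv {F : E3 → ℝ} {G : Fin 3 → E3 → ℝ}
    (hFs : HasCompactSupport F) (hG : ∀ j, MemLp (G j) (3 / 2) volume)
    (h : ∀ j, HasWeakPartialDeriv j F (G j)) : MemLp F 3 volume := by
  have hF : LocallyIntegrable F volume := (h 0).1
  have hb : ∀ n j, eLpNorm (mollify n (G j)) (3 / 2) volume ≤ eLpNorm (G j) (3 / 2) volume :=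
    fun n j => eLpNorm_mollify_le n (hG j).1 one_le_threeHalves threeHalves_ne_top
  have hm : ∀ n j, AEStronglyMeasurable (fun x => ‖mollify n (G j) x‖) volume := fun n j =>
    (contDiff_mollify n (h j).2.1).continuous.norm.aestronglyMeasurable
  set C : ℝ≥0 := SNormLESNormFDerivOfEqConst ℝ (volume : Measure E3) ((3 / 2 : ℝ≥0) : ℝ) with hC
  set S : ℝ≥0∞ := eLpNorm (G 0) (3 / 2) volume + eLpNorm (G 1) (3 / 2) volume +
    eLpNorm (G 2) (3 / 2) volume with hS
  have hSt : S ≠ ⊤ := by simp [hS, (hG _).2.ne]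
  have key : ∀ n, eLpNorm (mollify n F) 3 volume ≤ C * S := by
    intro n
    -- Gagliardo–Nirenberg–Sobolev for the smooth approximants: `1/3 = 2/3 - 1/3` in dimension
    -- three, with a constant independent of `n`.
    have h1 := eLpNorm_le_eLpNorm_fderiv_of_eq (volume : Measure E3) (u := mollify n F)
      (p := 3 / 2) (p' := 3) ((contDiff_mollify n hF).of_le (by simp))
      (hasCompactSupport_mollify n hFs)
      (by rw [← ENNReal.coe_le_coe]; push_cast; simpa using one_le_threeHalves) (by simp)
      (by simp; norm_num)
    have h32 : ((3 / 2 : ℝ≥0) : ℝ≥0∞) = 3 / 2 := by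
      rw [ENNReal.coe_div (by simp)]; rfl
    rw [h32] at h1
    refine h1.trans ?_
    gcongr
    have h2 : ∀ x, ‖fderiv ℝ (mollify n F) x‖ ≤ ‖mollify n (G 0) x‖ + ‖mollify n (G 1) x‖ +
        ‖mollify n (G 2) x‖ := by
      intro x
      simpa only [fderiv_mollify_apply n (h _) x] using
        norm_le_sum_apply_single (fderiv ℝ (mollify n F) x)
    calc eLpNorm (fderiv ℝ (mollify n F)) (3 / 2) volume
        ≤ eLpNorm ((fun x => ‖mollify n (G 0) x‖) + (fun x => ‖mollify n (G 1) x‖) +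
          (fun x => ‖mollify n (G 2) x‖)) (3 / 2) volume := eLpNorm_mono_real h2
      _ ≤ eLpNorm ((fun x => ‖mollify n (G 0) x‖) + (fun x => ‖mollify n (G 1) x‖)) (3 / 2) volume
          + eLpNorm (fun x => ‖mollify n (G 2) x‖) (3 / 2) volume :=
          eLpNorm_add_le ((hm n 0).add (hm n 1)) (hm n 2) one_le_threeHalves
      _ ≤ (eLpNorm (fun x => ‖mollify n (G 0) x‖) (3 / 2) volume +
          eLpNorm (fun x => ‖mollify n (G 1) x‖) (3 / 2) volume) +
          eLpNorm (fun x => ‖mollify n (G 2) x‖) (3 / 2) volume := by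
          gcongr
          exact eLpNorm_add_le (hm n 0) (hm n 1) one_le_threeHalves
      _ ≤ S := by
          simp only [eLpNorm_norm]
          exact add_le_add (add_le_add (hb n 0) (hb n 1)) (hb n 2)
  refine ⟨hF.aestronglyMeasurable, ?_⟩
  -- Fatou's lemma carries the uniform bound to the almost everywhere limit `F`.
  have h3 := Lp.eLpNorm_lim_le_liminf_eLpNorm (p := 3)
    (fun n => (contDiff_mollify n hF).continuous.aestronglyMeasurable (μ := volume)) F
    (ae_tendsto_mollify hF)
  refine h3.trans_lt (lt_of_le_of_lt (liminf_le_of_le (a := C * S) (by isBoundedDefault) ?_)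
    (ENNReal.mul_lt_top (by simp) hSt.lt_top))
  intro b hb'
  obtain ⟨n, hn⟩ := hb'.exists
  exact hn.trans (key n)

/-- A smooth cutoff equal to one near a given ball. -/
lemma exists_cutoff (R : ℝ) : ∃ χ : E3 → ℝ, ContDiff ℝ ∞ χ ∧ HasCompactSupport χ ∧
    (∀ x, ‖x‖ ≤ R → χ x = 1) ∧ ∀ x, ‖x‖ ≤ R → fderiv ℝ χ x = 0 := by
  let b : ContDiffBump (0 : E3) := ⟨|R| + 1, |R| + 2, by positivity, by linarith⟩
  have hb : ∀ x : E3, ‖x‖ ≤ R → x ∈ Metric.ball (0 : E3) b.rIn := by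
    intro x hx
    simp only [Metric.mem_ball, dist_zero_right, b]
    linarith [le_abs_self R]
  refine ⟨b, b.contDiff, b.hasCompactSupport,
    fun x hx => b.one_of_mem_closedBall (Metric.ball_subset_closedBall (hb x hx)), fun x hx => ?_⟩
  rw [(b.eventuallyEq_one_of_mem_ball (hb x hx)).fderiv_eq]
  simp

/-- Membership in `W^{1,3/2}_loc` for a scalar function with weak gradient `g`. -/
structure IsW1Loc (f : E3 → ℝ) (g : Fin 3 → E3 → ℝ) : Prop where
  memLpLoc : MemLpLoc (3 / 2) f
  memLpLoc_deriv : ∀ j, MemLpLoc (3 / 2) (g j)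
  weakDeriv : ∀ j, HasWeakPartialDeriv j f (g j)

lemma IsW1Loc.memLp_deriv_mul {f χ : E3 → ℝ} {g : Fin 3 → E3 → ℝ} (h : IsW1Loc f g)
    (hχ : ContDiff ℝ ∞ χ) (hχs : HasCompactSupport χ) (j : Fin 3) :
    MemLp (fun x => χ x * g j x + fderiv ℝ χ x (EuclideanSpace.single j 1) * f x) (3 / 2) volume :=
  ((h.memLpLoc_deriv j).mul_left hχ.continuous hχs).add
    (h.memLpLoc.mul_left ((hχ.continuous_fderiv (by simp)).clm_apply continuous_const)
      (hχs.fderiv_apply (𝕜 := ℝ) _))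

lemma IsW1Loc.memLp_three_mul {f χ : E3 → ℝ} {g : Fin 3 → E3 → ℝ} (h : IsW1Loc f g)
    (hχ : ContDiff ℝ ∞ χ) (hχs : HasCompactSupport χ) : MemLp (fun x => χ x * f x) 3 volume :=
  memLp_three_of_hasWeakPartialDeriv hχs.mul_right (h.memLp_deriv_mul hχ hχs)
    fun j => (h.weakDeriv j).mul_left hχ hχs

/-- Local Sobolev embedding `W^{1,3/2}_loc ⊆ L^3_loc`. -/
theorem IsW1Loc.memLpLoc_three {f : E3 → ℝ} {g : Fin 3 → E3 → ℝ} (h : IsW1Loc f g) :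
    MemLpLoc 3 f := by
  intro K hK
  obtain ⟨R, hR⟩ := hK.isBounded.exists_norm_le
  obtain ⟨χ, hχ, hχs, h1, -⟩ := exists_cutoff R
  refine ((h.memLp_three_mul hχ hχs).restrict K).ae_eq ?_
  filter_upwards [ae_restrict_mem hK.measurableSet] with x hx
  rw [h1 x (hR x hx), one_mul]

/-- Hölder: `‖a (B n - b)‖₁ ≤ ‖a‖_p ‖B n - b‖_q`. -/
lemma tendsto_integral_mul_of_tendsto_eLpNorm {p q : ℝ≥0∞} [ENNReal.HolderTriple p q 1]
    {a b : E3 → ℝ} {B : ℕ → E3 → ℝ} (ha : MemLp a p volume) (hb : MemLp b q volume)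
    (hB : ∀ n, MemLp (B n) q volume)
    (h : Tendsto (fun n => eLpNorm (B n - b) q volume) atTop (𝓝 0)) :
    Tendsto (fun n => ∫ x, a x * B n x) atTop (𝓝 (∫ x, a x * b x)) := by
  refine tendsto_integral_of_L1' (fun x => a x * b x) (ha.1.mul hb.1)
    (Eventually.of_forall fun n => ha.integrable_mul (hB n)) ?_
  have h0 : Tendsto (fun n => eLpNorm a p volume * eLpNorm (B n - b) q volume) atTop (𝓝 0) := by
    simpa using ENNReal.Tendsto.const_mul h (Or.inr ha.2.ne)
  refine tendsto_of_tendsto_of_tendsto_of_le_of_le tendsto_const_nhds h0 (fun _ => zero_le) ?_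
  intro n
  have e : (fun x => a x * B n x) - (fun x => a x * b x) = a • (B n - b) := by
    ext x; simp [mul_sub]
  change eLpNorm ((fun x => a x * B n x) - (fun x => a x * b x)) 1 volume ≤ _
  rw [e]
  exact eLpNorm_smul_le_mul_eLpNorm ((hB n).sub hb).1 ha.1

/-- Product rule for functions in `W^{1,3/2}_loc(ℝ³)`. -/
theorem IsW1Loc.integral_mul_mul_fderiv {f₁ f₂ : E3 → ℝ} {g₁ g₂ : Fin 3 → E3 → ℝ}
    (h₁ : IsW1Loc f₁ g₁) (h₂ : IsW1Loc f₂ g₂) (j : Fin 3) {φ : E3 → ℝ} (hφ : ContDiff ℝ ∞ φ)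
    (hφs : HasCompactSupport φ) :
    ∫ x, f₁ x * f₂ x * fderiv ℝ φ x (EuclideanSpace.single j 1) =
      - ∫ x, (g₁ j x * f₂ x + f₁ x * g₂ j x) * φ x := by
  obtain ⟨R, hR⟩ := hφs.isBounded.exists_norm_le
  -- Multiplying `f₁` by `χ` puts it and its derivatives in global Lebesgue spaces; nothing changes
  -- on the support of `φ`, where `χ = 1` and its gradient vanishes.
  obtain ⟨χ, hχ, hχs, hχ1, hχd⟩ := exists_cutoff R
  set dφ : E3 → ℝ := fun x => fderiv ℝ φ x (EuclideanSpace.single j 1) with hdφ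
  have hdc : Continuous dφ := (hφ.continuous_fderiv (by simp)).clm_apply continuous_const
  have hds : HasCompactSupport dφ := hφs.fderiv_apply (𝕜 := ℝ) _
  set F : E3 → ℝ := fun x => χ x * f₁ x with hF
  set G : E3 → ℝ := fun x => χ x * g₁ j x + fderiv ℝ χ x (EuclideanSpace.single j 1) * f₁ x with hG
  have hF3 : MemLp F 3 volume := h₁.memLp_three_mul hχ hχs
  have hG32 : MemLp G (3 / 2) volume := h₁.memLp_deriv_mul hχ hχs j
  have hw : HasWeakPartialDeriv j F G := (h₁.weakDeriv j).mul_left hχ hχs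
  have hFn : ∀ n, ContDiff ℝ ∞ (mollify n F) := fun n => contDiff_mollify n hw.1
  have hGn : ∀ n, ContDiff ℝ ∞ (mollify n G) := fun n => contDiff_mollify n hw.2.1
  have a1 : MemLp (fun x => φ x * f₂ x) 3 volume :=
    h₂.memLpLoc_three.mul_left hφ.continuous hφs
  have a2 : MemLp (fun x => dφ x * f₂ x) (3 / 2) volume := h₂.memLpLoc.mul_left hdc hds
  have a3 : MemLp (fun x => φ x * g₂ j x) (3 / 2) volume :=
    (h₂.memLpLoc_deriv j).mul_left hφ.continuous hφs
  have hFnL : ∀ n, MemLp (mollify n F) 3 volume := fun n =>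
    ⟨(hFn n).continuous.aestronglyMeasurable,
      (eLpNorm_mollify_le n hF3.1 (by norm_num) (by simp)).trans_lt hF3.2⟩
  have hGnL : ∀ n, MemLp (mollify n G) (3 / 2) volume := fun n =>
    ⟨(hGn n).continuous.aestronglyMeasurable,
      (eLpNorm_mollify_le n hG32.1 one_le_threeHalves threeHalves_ne_top).trans_lt hG32.2⟩
  have tF := tendsto_eLpNorm_mollify_sub (by norm_num) (by simp) hF3
  have tG := tendsto_eLpNorm_mollify_sub one_le_threeHalves threeHalves_ne_top hG32
  have t1 := tendsto_integral_mul_of_tendsto_eLpNorm a1 hG32 hGnL tG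
  have t2 := tendsto_integral_mul_of_tendsto_eLpNorm a2 hF3 hFnL tF
  have t3 := tendsto_integral_mul_of_tendsto_eLpNorm a3 hF3 hFnL tF
  -- After mollification, `mollify n F * φ` is an admissible test function for the weak derivative
  -- of `f₂`. All three integrals then converge by Hölder.
  have eq : ∀ n, (∫ x, φ x * f₂ x * mollify n G x) + ∫ x, dφ x * f₂ x * mollify n F x =
      - ∫ x, φ x * g₂ j x * mollify n F x := by
    intro n
    have hp := (h₂.weakDeriv j).2.2 (fun x => mollify n F x * φ x) ((hFn n).mul hφ) hφs.mul_left
    have hder : ∀ x, fderiv ℝ (fun x => mollify n F x * φ x) x (EuclideanSpace.single j 1) =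
        mollify n F x * dφ x + φ x * mollify n G x := by
      intro x
      rw [fderiv_fun_mul ((hFn n).differentiable (by simp)).differentiableAt
        (hφ.differentiable (by simp)).differentiableAt]
      simp [← fderiv_mollify_apply n hw x, hdφ]
    simp only [hder] at hp
    refine (integral_add (a1.integrable_mul (hGnL n)) (a2.integrable_mul (hFnL n))).symm.trans ?_
    calc _ = ∫ x, f₂ x * (mollify n F x * dφ x + φ x * mollify n G x) := by
          congr 1; ext x; simp only [Pi.mul_apply]; ring
      _ = _ := hp
      _ = _ := by congr 2; ext x; ring
  have lim := tendsto_nhds_unique (t1.add t2) (t3.neg.congr fun n => (eq n).symm)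
  have hχφ : ∀ x, φ x * χ x = φ x := by
    intro x
    by_cases hx : x ∈ tsupport φ
    · rw [hχ1 x (hR x hx), mul_one]
    · rw [image_eq_zero_of_notMem_tsupport hx, zero_mul]
  have hχdφ : ∀ x, dφ x * χ x = dφ x := by
    intro x
    by_cases hx : x ∈ tsupport φ
    · rw [hχ1 x (hR x hx), mul_one]
    · have : dφ x = 0 := by
        have := image_eq_zero_of_notMem_tsupport fun h => hx (tsupport_fderiv_subset ℝ h)
        simp [hdφ, this]
      rw [this, zero_mul]
  have hφdχ : ∀ x, φ x * fderiv ℝ χ x (EuclideanSpace.single j 1) = 0 := by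
    intro x
    by_cases hx : x ∈ tsupport φ
    · simp [hχd x (hR x hx)]
    · rw [image_eq_zero_of_notMem_tsupport hx, zero_mul]
  have e1 : ∀ x, φ x * f₂ x * G x = g₁ j x * f₂ x * φ x := fun x => by
    linear_combination (f₂ x * g₁ j x) * hχφ x + (f₂ x * f₁ x) * hφdχ x
  have e2 : ∀ x, dφ x * f₂ x * F x = f₁ x * f₂ x * dφ x := fun x => by
    linear_combination (f₂ x * f₁ x) * hχdφ x
  have e3 : ∀ x, φ x * g₂ j x * F x = f₁ x * g₂ j x * φ x := fun x => by
    linear_combination (g₂ j x * f₁ x) * hχφ x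
  have i1 : Integrable (fun x => g₁ j x * f₂ x * φ x) volume :=
    (a1.integrable_mul hG32).congr (Eventually.of_forall e1)
  have i3 : Integrable (fun x => f₁ x * g₂ j x * φ x) volume :=
    (a3.integrable_mul hF3).congr (Eventually.of_forall e3)
  simp only [e1, e2, e3] at lim
  simp only [add_mul]
  rw [integral_add i1 i3]
  linarith

/-! ### The divergence-free stress tensor -/

lemma IsW1pLocWithJacobian.isW1Loc {u : E3 → E3} {J : E3 → Matrix (Fin 3) (Fin 3) ℝ}
    (h : IsW1pLocWithJacobian (3 / 2) u J) (i : Fin 3) :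
    IsW1Loc (fun x => u x i) (fun j x => J x i j) where
  memLpLoc K hK := by
    refine (h.memLpLoc K hK).of_le ?_ (Eventually.of_forall fun x => PiLp.norm_apply_le (u x) i)
    exact (EuclideanSpace.proj i : E3 →L[ℝ] ℝ).continuous.comp_aestronglyMeasurable
      (h.memLpLoc K hK).1
  memLpLoc_deriv j := h.memLpLoc_jacobian i j
  weakDeriv j := h.weakDeriv i j

/-- Hölder with `1/3 + 2/3 = 1`; this gives meaning to the quadratic terms `u_i ∂_k u_j`. -/
lemma MemLpLoc.integrable_mul_mul {f g ψ : E3 → ℝ} (hf : MemLpLoc 3 f) (hg : MemLpLoc (3 / 2) g)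
    (hψ : Continuous ψ) (hψs : HasCompactSupport ψ) :
    Integrable (fun x => f x * g x * ψ x) volume := by
  have h : MemLpLoc 1 fun x => f x * g x := fun K hK => MemLp.mul (hg K hK) (hf K hK)
  exact LocallyIntegrable.integrable_mul_of_hasCompactSupport (h.locallyIntegrable le_rfl) hψ hψs

/-- The stress tensor `u ⊗ u - |u|² / 2` of a Beltrami flow is weakly divergence free. -/
theorem integral_stress_eq_zero {u : E3 → E3} (hu : IsWeakBeltramiFlow u) (Φ : Fin 3 → E3 → ℝ)
    (hΦ : ∀ i, ContDiff ℝ ∞ (Φ i)) (hΦs : ∀ i, HasCompactSupport (Φ i)) :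
    Integrable (fun x => ∑ i, ∑ j, (u x i * u x j *
      fderiv ℝ (Φ i) x (EuclideanSpace.single j 1) -
      u x j * u x j * fderiv ℝ (Φ i) x (EuclideanSpace.single i 1) / 2)) volume ∧
    ∫ x, ∑ i, ∑ j, (u x i * u x j * fderiv ℝ (Φ i) x (EuclideanSpace.single j 1) -
      u x j * u x j * fderiv ℝ (Φ i) x (EuclideanSpace.single i 1) / 2) = 0 := by
  obtain ⟨J, hJ, hB⟩ := hu
  have hW := fun i => hJ.isW1Loc i
  have h3 : ∀ i, MemLpLoc 3 fun x => u x i := fun i => (hW i).memLpLoc_three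
  have hdc : ∀ i j, Continuous fun x => fderiv ℝ (Φ i) x (EuclideanSpace.single j 1) := fun i j =>
    ((hΦ i).continuous_fderiv (by simp)).clm_apply continuous_const
  have hds : ∀ i j, HasCompactSupport fun x => fderiv ℝ (Φ i) x (EuclideanSpace.single j 1) :=
    fun i j => (hΦs i).fderiv_apply (𝕜 := ℝ) _
  have iu : ∀ i j k l, Integrable
      (fun x => u x i * u x j * fderiv ℝ (Φ k) x (EuclideanSpace.single l 1)) volume :=
    fun i j k l => (h3 i).integrable_mul_mul (hW j).memLpLoc (hdc k l) (hds k l)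
  have iJ : ∀ i j k l, Integrable (fun x => u x i * J x j k * Φ l x) volume :=
    fun i j k l => (h3 i).integrable_mul_mul (hJ.memLpLoc_jacobian j k) (hΦ l).continuous (hΦs l)
  have iT : ∀ i j, Integrable (fun x => u x i * u x j *
      fderiv ℝ (Φ i) x (EuclideanSpace.single j 1) -
      u x j * u x j * fderiv ℝ (Φ i) x (EuclideanSpace.single i 1) / 2) volume :=
    fun i j => (iu i j i j).sub ((iu j j i i).div_const 2)
  have iA : ∀ i j, Integrable (fun x => u x j * J x i j * Φ i x + u x i * J x j j * Φ i x) volume :=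
    fun i j => (iJ j i j i).add (iJ i j j i)
  have iS : ∀ i j, Integrable (fun x => (u x j * J x i j * Φ i x + u x i * J x j j * Φ i x) -
      u x j * J x j i * Φ i x) volume :=
    fun i j => (iA i j).sub (iJ j j i i)
  have hTS : ∀ i j, ∫ x, (u x i * u x j * fderiv ℝ (Φ i) x (EuclideanSpace.single j 1) -
      u x j * u x j * fderiv ℝ (Φ i) x (EuclideanSpace.single i 1) / 2) =
      - ∫ x, ((u x j * J x i j * Φ i x + u x i * J x j j * Φ i x) - u x j * J x j i * Φ i x) := by
    intro i j
    have e1 := (hW i).integral_mul_mul_fderiv (hW j) j (hΦ i) (hΦs i)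
    have e2 := (hW j).integral_mul_mul_fderiv (hW j) i (hΦ i) (hΦs i)
    have e3 : ∫ x, (J x j i * u x j + u x j * J x j i) * Φ i x =
        2 * ∫ x, u x j * J x j i * Φ i x := by
      rw [← integral_const_mul]; congr 1; ext x; ring
    have e4 : ∫ x, (J x i j * u x j + u x i * J x j j) * Φ i x =
        ∫ x, (u x j * J x i j * Φ i x + u x i * J x j j * Φ i x) := by
      congr 1; ext x; ring
    rw [integral_sub (iu i j i j) ((iu j j i i).div_const 2), integral_div, e1, e2, e3, e4,
      integral_sub (iA i j) (iJ j j i i)]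
    ring
  refine ⟨integrable_finsetSum _ fun i _ => integrable_finsetSum _ fun j _ => iT i j, ?_⟩
  rw [integral_finsetSum _ fun i _ => integrable_finsetSum _ fun j _ => iT i j]
  simp_rw [integral_finsetSum _ fun j _ => iT _ j, hTS, Finset.sum_neg_distrib]
  simp_rw [← integral_finsetSum _ fun j _ => iS _ j]
  rw [← integral_finsetSum _ fun i _ => integrable_finsetSum _ fun j _ => iS i j, neg_eq_zero]
  refine integral_eq_zero_of_ae ?_
  filter_upwards [hB] with x hx
  obtain ⟨hc, hd⟩ := hx
  have c0 := congrFun hc 0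
  have c1 := congrFun hc 1
  have c2 := congrFun hc 2
  simp only [cross_apply, curlOfJacobian, divOfJacobian, Fin.sum_univ_three, Matrix.cons_val_zero,
    Matrix.cons_val_one, Matrix.cons_val, Pi.zero_apply] at c0 c1 c2 hd
  simp only [Fin.sum_univ_three, Pi.zero_apply]
  -- The integrand is `Φ · (curl u × u) + (u · Φ) div u`, because `(u · ∇)u - ∇|u|²/2 = curl u × u`.
  linear_combination Φ 0 x * c0 + Φ 1 x * c1 + Φ 2 x * c2 +
    (u x 0 * Φ 0 x + u x 1 * Φ 1 x + u x 2 * Φ 2 x) * hd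

/-! ### The weighted energy estimate -/

/-- The radial weight `(1 + |x|²)^{-1/2}`. -/
noncomputable def weight (x : E3) : ℝ := (√(1 + ‖x‖ ^ 2))⁻¹

lemma weight_pos (x : E3) : 0 < weight x := by unfold weight; positivity

lemma weight_sq (x : E3) : weight x ^ 2 * (1 + ‖x‖ ^ 2) = 1 := by
  rw [weight, inv_pow, Real.sq_sqrt (by positivity)]
  exact inv_mul_cancel₀ (by positivity)

lemma contDiff_weight : ContDiff ℝ ∞ weight := by
  unfold weight
  refine ContDiff.inv (ContDiff.sqrt (contDiff_const.add (contDiff_norm_sq ℝ)) ?_) ?_ <;>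
  · intro x; positivity

lemma fderiv_weight (x v : E3) : fderiv ℝ weight x v = -(weight x ^ 3) * inner ℝ x v := by
  have h1 : HasFDerivAt (fun x : E3 => ‖x‖ ^ 2) _ x := (hasStrictFDerivAt_norm_sq x).hasFDerivAt
  have hs : √(1 + ‖x‖ ^ 2) ≠ 0 := by positivity
  have h2 : HasDerivAt (fun s : ℝ => (√(1 + s))⁻¹) _ (‖x‖ ^ 2) :=
    (((hasDerivAt_id (‖x‖ ^ 2)).const_add 1).sqrt (by simp; positivity)).inv hs
  have h3 := HasDerivAt.comp_hasFDerivAt (h₂ := fun s : ℝ => (√(1 + s))⁻¹) x h2 h1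
  change HasFDerivAt weight _ x at h3
  rw [h3.fderiv]
  simp [weight]
  field_simp

/-- Pythagoras, multiplied by `‖x‖²` so that it also holds at the origin. -/
lemma norm_tangentialPart_sq_mul (u : E3 → E3) (x : E3) :
    ‖tangentialPart u x‖ ^ 2 * ‖x‖ ^ 2 = ‖u x‖ ^ 2 * ‖x‖ ^ 2 - inner ℝ (u x) x ^ 2 := by
  rcases eq_or_ne x 0 with rfl | hx
  · simp
  · have hx' : ‖x‖ ≠ 0 := norm_ne_zero_iff.2 hx
    rw [tangentialPart, normalPart, norm_sub_sq_real]
    simp only [inner_smul_right, norm_smul, norm_inv, mul_pow, inv_pow, Real.norm_eq_abs,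
      abs_mul, sq_abs, abs_norm, abs_inv]
    field_simp
    ring

/-- The energy estimate for a radially nonincreasing cutoff function. -/
theorem lintegral_weight_le {u : E3 → E3} (hu : IsWeakBeltramiFlow u) {η m : E3 → ℝ}
    (hη : ContDiff ℝ ∞ η) (hηs : HasCompactSupport η) (hη0 : ∀ x, 0 ≤ η x) (hm : ∀ x, 0 ≤ m x)
    (hd : ∀ x v, fderiv ℝ η x v = -m x * inner ℝ x v) :
    ∫⁻ x, ENNReal.ofReal (η x * weight x ^ 3 * ‖u x‖ ^ 2) ≤
      ∫⁻ x, ENNReal.ofReal (‖fderiv ℝ η x‖ * ‖tangentialPart u x‖ ^ 2) := by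
  set Φ : Fin 3 → E3 → ℝ := fun i x => η x * (weight x * x i) with hΦdef
  have hcoord : ∀ i, ContDiff ℝ ∞ fun x : E3 => x i := fun i =>
    (EuclideanSpace.proj i : E3 →L[ℝ] ℝ).contDiff
  have hΦ : ∀ i, ContDiff ℝ ∞ (Φ i) := fun i => hη.mul (contDiff_weight.mul (hcoord i))
  have hΦs : ∀ i, HasCompactSupport (Φ i) := fun i => hηs.mul_right
  have hΦd : ∀ i x v, fderiv ℝ (Φ i) x v = η x * weight x * v i -
      (m x * weight x + η x * weight x ^ 3) * x i * inner ℝ x v := by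
    intro i x v
    have h1 : HasFDerivAt η (fderiv ℝ η x) x :=
      (hη.differentiable (by simp)).differentiableAt.hasFDerivAt
    have h2 : HasFDerivAt weight (fderiv ℝ weight x) x :=
      (contDiff_weight.differentiable (by simp)).differentiableAt.hasFDerivAt
    have h3 : HasFDerivAt (fun x : E3 => x i) (EuclideanSpace.proj i : E3 →L[ℝ] ℝ) x :=
      (EuclideanSpace.proj i : E3 →L[ℝ] ℝ).hasFDerivAt
    have h4 : HasFDerivAt (Φ i) _ x := h1.mul (h2.mul h3)
    rw [h4.fderiv]
    simp [hd, fderiv_weight]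
    ring
  obtain ⟨hQi, hzero⟩ := integral_stress_eq_zero hu Φ hΦ hΦs
  set Q : E3 → ℝ := fun x => ∑ i, ∑ j, (u x i * u x j *
    fderiv ℝ (Φ i) x (EuclideanSpace.single j 1) -
      u x j * u x j * fderiv ℝ (Φ i) x (EuclideanSpace.single i 1) / 2) with hQ
  -- `∇Φ` is `η w I - (m w + η w³) x ⊗ x`, and contracting the identity with the stress tensor gives
  -- `|u|² - 3|u|²/2 = -|u|²/2`.
  have hQeq : ∀ x, 2 * Q x = ‖u x‖ ^ 2 * ((m x * weight x + η x * weight x ^ 3) * ‖x‖ ^ 2 -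
      η x * weight x) - 2 * (m x * weight x + η x * weight x ^ 3) * inner ℝ (u x) x ^ 2 := by
    intro x
    simp only [hQ, hΦd, EuclideanSpace.real_norm_sq_eq, PiLp.inner_apply, Fin.sum_univ_three]
    simp
    ring
  have hpt : ∀ x, η x * weight x ^ 3 * ‖u x‖ ^ 2 + 2 * Q x ≤
      ‖fderiv ℝ η x‖ * ‖tangentialPart u x‖ ^ 2 := by
    intro x
    have hw := weight_pos x
    have hw2 := weight_sq x
    -- Writing `η w = η w³ (1 + |x|²)` leaves exactly `-η w³ |u|²` in `2 Q`, which the added energy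
    -- cancels; the `(u · x)²` term that remains is nonpositive.
    have e : η x * weight x ^ 3 * ‖u x‖ ^ 2 + 2 * Q x = m x * weight x *
        (‖u x‖ ^ 2 * ‖x‖ ^ 2 - inner ℝ (u x) x ^ 2) -
        (m x * weight x + 2 * (η x * weight x ^ 3)) * inner ℝ (u x) x ^ 2 := by
      rw [hQeq]
      linear_combination (η x * weight x * ‖u x‖ ^ 2) * hw2
    have hT := norm_tangentialPart_sq_mul u x
    have hT0 := sq_nonneg ‖tangentialPart u x‖
    have h1 : 0 ≤ (m x * weight x + 2 * (η x * weight x ^ 3)) * inner ℝ (u x) x ^ 2 := by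
      have := hm x
      have := hη0 x
      positivity
    have h2 : weight x * ‖x‖ ≤ 1 := by
      refine abs_le_of_sq_le_sq' ?_ zero_le_one |>.2
      nlinarith [sq_nonneg (weight x)]
    have h3 : m x * ‖x‖ ≤ ‖fderiv ℝ η x‖ := by
      rcases eq_or_ne x 0 with rfl | hx
      · simp
      · have hx' : 0 < ‖x‖ := norm_pos_iff.2 hx
        have := (fderiv ℝ η x).le_opNorm x
        rw [hd, real_inner_self_eq_norm_sq, neg_mul, norm_neg, Real.norm_of_nonneg
          (mul_nonneg (hm x) (sq_nonneg _))] at this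
        refine le_of_mul_le_mul_right ?_ hx'
        linarith
    have h4 : m x * weight x * (‖tangentialPart u x‖ ^ 2 * ‖x‖ ^ 2) ≤
        ‖fderiv ℝ η x‖ * ‖tangentialPart u x‖ ^ 2 := by
      calc _ = (weight x * ‖x‖) * (m x * ‖x‖) * ‖tangentialPart u x‖ ^ 2 := by ring
        _ ≤ 1 * ‖fderiv ℝ η x‖ * ‖tangentialPart u x‖ ^ 2 := by
          have := mul_nonneg (hm x) (norm_nonneg x)
          gcongr
        _ = _ := by ring
    rw [e, ← hT]
    linarith
  have hi : Integrable (fun x => η x * weight x ^ 3 * ‖u x‖ ^ 2) volume := by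
    obtain ⟨J, hJ, -⟩ := hu
    have hψ : Continuous fun x => η x * weight x ^ 3 :=
      hη.continuous.mul (contDiff_weight.continuous.pow 3)
    have := integrable_finsetSum Finset.univ fun i (_ : i ∈ Finset.univ) =>
      (hJ.isW1Loc i).memLpLoc_three.integrable_mul_mul (hJ.isW1Loc i).memLpLoc hψ hηs.mul_right
    refine this.congr (Eventually.of_forall fun x => ?_)
    simp only [EuclideanSpace.real_norm_sq_eq, Fin.sum_univ_three]
    ring
  have hsum : ∫ x, (η x * weight x ^ 3 * ‖u x‖ ^ 2 + 2 * Q x) =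
      ∫ x, η x * weight x ^ 3 * ‖u x‖ ^ 2 := by
    rw [integral_add hi (hQi.const_mul 2), integral_const_mul, hzero]
    ring
  have hnn : 0 ≤ᵐ[volume] fun x => η x * weight x ^ 3 * ‖u x‖ ^ 2 :=
    Eventually.of_forall fun x => by
      have := hη0 x
      have := weight_pos x
      simp only [Pi.zero_apply]
      positivity
  have hi2 : Integrable (fun x => η x * weight x ^ 3 * ‖u x‖ ^ 2 + 2 * Q x) volume :=
    hi.add (hQi.const_mul 2)
  -- Dropping the negative part of the integrand permits a comparison of lower integrals, so the
  -- right side need not be known finite or measurable.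
  rw [← ofReal_integral_eq_lintegral_ofReal hi hnn, ← hsum,
    integral_eq_lintegral_pos_part_sub_lintegral_neg_part hi2]
  refine (ENNReal.ofReal_le_ofReal (sub_le_self _ ENNReal.toReal_nonneg)).trans ?_
  refine ENNReal.ofReal_toReal_le.trans (lintegral_mono fun x => ENNReal.ofReal_le_ofReal (hpt x))

lemma IsWeakBeltramiFlow.aestronglyMeasurable {u : E3 → E3} (hu : IsWeakBeltramiFlow u) :
    AEStronglyMeasurable u volume := by
  obtain ⟨J, hJ, -⟩ := hu
  have h1 : ∀ i, AEMeasurable (fun x => u x i) volume := fun i =>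
    (hJ.weakDeriv i 0).1.aestronglyMeasurable.aemeasurable
  have h2 : AEMeasurable (fun x => (u x).ofLp) volume := aemeasurable_pi_lambda _ h1
  exact ((WithLp.measurable_toLp 2 (Fin 3 → ℝ)).comp_aemeasurable h2).aestronglyMeasurable

/-- The energy estimate for a cutoff function given by a radial profile. -/
theorem lintegral_ball_weight_le {u : E3 → E3} (hu : IsWeakBeltramiFlow u) {h : ℝ → ℝ} {b B : ℝ}
    (hb : 0 < b) (hh : ContDiff ℝ ∞ h) (hanti : Antitone h) (h1 : ∀ r ≤ b, h r = 1)
    (h0 : ∀ r, B ≤ r → h r = 0) :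
    ∫⁻ x in Metric.ball 0 b, ENNReal.ofReal (weight x ^ 3 * ‖u x‖ ^ 2) ≤
      ∫⁻ x, ENNReal.ofReal (|deriv h ‖x‖| * ‖tangentialPart u x‖ ^ 2) := by
  set η : E3 → ℝ := fun x => h ‖x‖ with hη
  -- The norm is not smooth at the origin, but the profile is constant there.
  have hconst : ∀ x : E3, ‖x‖ < b → η =ᶠ[𝓝 x] fun _ => 1 := by
    intro x hx
    filter_upwards [continuous_norm.continuousAt.eventually (gt_mem_nhds hx)] with y hy
    exact h1 _ (le_of_lt hy)
  have hsm : ContDiff ℝ ∞ η := by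
    rw [contDiff_iff_contDiffAt]
    intro x
    by_cases hx : ‖x‖ < b
    · exact contDiffAt_const.congr_of_eventuallyEq (hconst x hx)
    · have hx0 : x ≠ 0 := fun hx' => hx (by simpa [hx'] using hb)
      exact hh.contDiffAt.comp x (contDiffAt_norm ℝ hx0)
  have hnn : ∀ r, 0 ≤ h r := fun r => by
    rw [← h0 (max r B) (le_max_right _ _)]
    exact hanti (le_max_left _ _)
  have hs : HasCompactSupport η := by
    refine HasCompactSupport.intro (isCompact_closedBall (0 : E3) B) fun x hx => h0 _ ?_
    simp only [Metric.mem_closedBall, dist_zero_right, not_le] at hx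
    exact hx.le
  -- At the origin the quotient takes the value 0, consistent with the vanishing gradient.
  have hd : ∀ x v, fderiv ℝ η x v = -(-deriv h ‖x‖ / ‖x‖) * inner ℝ x v := by
    intro x v
    rcases eq_or_ne x 0 with rfl | hx
    · rw [(hconst 0 (by simpa using hb)).fderiv_eq]
      simp
    · have hx' : ‖x‖ ^ 2 ≠ 0 := by simpa using hx
      have e1 : HasFDerivAt (fun y : E3 => √(‖y‖ ^ 2)) _ x :=
        (hasStrictFDerivAt_norm_sq x).hasFDerivAt.sqrt hx'
      simp only [Real.sqrt_sq (norm_nonneg _)] at e1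
      have e2 := HasDerivAt.comp_hasFDerivAt x
        (hh.differentiable (by simp)).differentiableAt.hasDerivAt e1
      change HasFDerivAt η _ x at e2
      rw [e2.fderiv]
      simp
      ring
  have hnorm : ∀ x, ‖fderiv ℝ η x‖ ≤ |deriv h ‖x‖| := by
    intro x
    refine ContinuousLinearMap.opNorm_le_bound _ (abs_nonneg _) fun v => ?_
    rw [hd]
    rcases eq_or_ne x 0 with rfl | hx
    · simp; positivity
    · have hx' : 0 < ‖x‖ := norm_pos_iff.2 hx
      rw [norm_mul, Real.norm_eq_abs, abs_neg, abs_div, abs_neg, abs_norm, div_mul_eq_mul_div,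
        div_le_iff₀ hx', mul_assoc, mul_comm ‖v‖]
      exact mul_le_mul_of_nonneg_left (norm_inner_le_norm x v) (abs_nonneg _)
  have key := lintegral_weight_le hu hsm hs (fun x => hnn _)
    (fun x => div_nonneg (neg_nonneg.2 hanti.deriv_nonpos) (norm_nonneg x)) hd
  calc ∫⁻ x in Metric.ball 0 b, ENNReal.ofReal (weight x ^ 3 * ‖u x‖ ^ 2)
      = ∫⁻ x in Metric.ball 0 b, ENNReal.ofReal (η x * weight x ^ 3 * ‖u x‖ ^ 2) := by
        refine setLIntegral_congr_fun Metric.isOpen_ball.measurableSet fun x hx => ?_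
        simp only [hη]
        rw [h1 ‖x‖ (by simpa using (Metric.mem_ball.1 hx).le), one_mul]
    _ ≤ ∫⁻ x, ENNReal.ofReal (η x * weight x ^ 3 * ‖u x‖ ^ 2) := setLIntegral_le_lintegral _ _
    _ ≤ _ := key
    _ ≤ _ := lintegral_mono fun x => ENNReal.ofReal_le_ofReal (by gcongr; exact hnorm x)

/-! ### Radial cutoffs and the Liouville criterion -/

/-- A smooth transition from one on `(-∞, 1/2]` to zero on `[1, ∞)`. -/
noncomputable def transition (t : ℝ) : ℝ := 1 - Real.smoothTransition (2 * t - 1)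

lemma contDiff_transition : ContDiff ℝ ∞ transition :=
  contDiff_const.sub (Real.smoothTransition.contDiff.comp
    ((contDiff_const.mul contDiff_id).sub contDiff_const))

lemma antitone_transition : Antitone transition := fun s t hst =>
  sub_le_sub_left (Real.smoothTransition.monotone (by linarith)) _

lemma transition_of_le {t : ℝ} (ht : t ≤ 1 / 2) : transition t = 1 := by
  rw [transition, Real.smoothTransition.zero_of_nonpos (by linarith), sub_zero]

lemma transition_of_ge {t : ℝ} (ht : 1 ≤ t) : transition t = 0 := by
  rw [transition, Real.smoothTransition.one_of_one_le (by linarith), sub_self]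

lemma transition_nonneg (t : ℝ) : 0 ≤ transition t :=
  sub_nonneg.2 (Real.smoothTransition.le_one _)

lemma transition_le_one (t : ℝ) : transition t ≤ 1 :=
  sub_le_self _ (Real.smoothTransition.nonneg _)

/-- The maximum 1 is attained on the plateau, which settles the endpoint `1/2` as well. -/
lemma deriv_transition_of_le {t : ℝ} (ht : t ≤ 1 / 2) : deriv transition t = 0 := by
  refine IsLocalMax.deriv_eq_zero (Eventually.of_forall fun s => ?_)
  rw [transition_of_le ht]
  exact transition_le_one s

lemma deriv_transition_of_ge {t : ℝ} (ht : 1 ≤ t) : deriv transition t = 0 := by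
  refine IsLocalMin.deriv_eq_zero (Eventually.of_forall fun s => ?_)
  rw [transition_of_ge ht]
  exact transition_nonneg s

lemma exists_abs_deriv_transition_le : ∃ C : ℝ, ∀ t, |deriv transition t| ≤ C := by
  have hs : HasCompactSupport (deriv transition) := by
    refine HasCompactSupport.intro (isCompact_Icc (a := (1 / 2 : ℝ)) (b := 1)) fun t ht => ?_
    by_cases h : t ≤ 1 / 2
    · exact deriv_transition_of_le h
    · exact deriv_transition_of_ge (le_of_not_ge fun h' => ht ⟨(not_le.1 h).le, h'⟩)
  exact hs.exists_bound_of_continuous (contDiff_transition.continuous_deriv (by simp))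

/-- A Liouville criterion: the tangential energy measured at the scale of an increasing radial
function `L` with derivative `L'` has to be negligible. -/
theorem ae_eq_zero_of_tendsto {u : E3 → E3} (hu : IsWeakBeltramiFlow u) {a : ℝ} (ha : 0 < a)
    {L L' : ℝ → ℝ} (hL : ContDiffOn ℝ ∞ L (Ioi a)) (hLd : ∀ r, a < r → HasDerivAt L (L' r) r)
    (hLd0 : ∀ r, a < r → 0 ≤ L' r) (hlim : Tendsto L atTop atTop)
    (h : Tendsto (fun R => ENNReal.ofReal (1 / L R) *
      ∫⁻ x in {x : E3 | a < ‖x‖ ∧ ‖x‖ < R ∧ L R / 2 < L ‖x‖},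
        ENNReal.ofReal (L' ‖x‖ * ‖tangentialPart u x‖ ^ 2)) atTop (𝓝 0)) :
    u =ᵐ[volume] 0 := by
  have hmono : MonotoneOn L (Ioi a) := by
    refine monotoneOn_of_deriv_nonneg (convex_Ioi a)
      (fun r hr => (hLd r hr).continuousAt.continuousWithinAt) ?_ ?_
    · rw [interior_Ioi]
      exact fun r hr => (hLd r hr).differentiableAt.differentiableWithinAt
    · rw [interior_Ioi]
      exact fun r hr => by rw [(hLd r hr).deriv]; exact hLd0 r hr
  obtain ⟨C, hC⟩ := exists_abs_deriv_transition_le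
  have hC0 : 0 ≤ C := (abs_nonneg _).trans (hC 0)
  have step : ∀ b, a < b → ∀ᶠ R in atTop,
      ∫⁻ x in Metric.ball 0 b, ENNReal.ofReal (weight x ^ 3 * ‖u x‖ ^ 2) ≤
      ENNReal.ofReal C * (ENNReal.ofReal (1 / L R) *
      ∫⁻ x in {x : E3 | a < ‖x‖ ∧ ‖x‖ < R ∧ L R / 2 < L ‖x‖},
        ENNReal.ofReal (L' ‖x‖ * ‖tangentialPart u x‖ ^ 2)) := by
    intro b hab
    filter_upwards [hlim.eventually_ge_atTop (2 * L (b + 1)), hlim.eventually_gt_atTop 0,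
      eventually_gt_atTop (b + 1)] with R hR1 hR0 hRb
    -- `L` is controlled only beyond `a`, so the value 1 is imposed up to `b`. As `2 L(b + 1) ≤ L
    -- R`, both branches equal 1 on `(b, b + 1)` and the gluing is smooth.
    set g : ℝ → ℝ := fun r => if r ≤ b then 1 else transition (L r / L R) with hg
    have g1 : ∀ r, r < b + 1 → g r = 1 := by
      intro r hr
      simp only [hg]
      split_ifs with hrb
      · rfl
      · apply transition_of_le
        rw [div_le_div_iff₀ hR0 two_pos]
        have := hmono (mem_Ioi.2 (hab.trans (not_le.1 hrb))) (mem_Ioi.2 (by linarith)) hr.le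
        linarith
    have g2 : ∀ r, b < r → g r = transition (L r / L R) := fun r hr => if_neg (not_le.2 hr)
    have gsm : ContDiff ℝ ∞ g := by
      rw [contDiff_iff_contDiffAt]
      intro r
      by_cases hr : r < b + 1
      · refine contDiffAt_const.congr_of_eventuallyEq (f := fun _ => (1 : ℝ)) ?_
        filter_upwards [gt_mem_nhds hr] with s hs using g1 s hs
      · have hr' : b < r := by linarith
        refine ContDiffAt.congr_of_eventuallyEq (f := fun r => transition (L r / L R)) ?_ ?_
        · exact contDiff_transition.contDiffAt.comp r
            ((hL.contDiffAt (Ioi_mem_nhds (hab.trans hr'))).div_const _)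
        · filter_upwards [lt_mem_nhds hr'] with s hs using g2 s hs
    have ganti : Antitone g := by
      intro r s hrs
      by_cases hr : r < b + 1
      · rw [g1 r hr]
        simp only [hg]
        split_ifs
        · rfl
        · exact transition_le_one _
      · have hr' : b < r := by linarith
        rw [g2 r hr', g2 s (hr'.trans_le hrs)]
        apply antitone_transition
        have := hmono (mem_Ioi.2 (hab.trans hr')) (mem_Ioi.2 (hab.trans (hr'.trans_le hrs))) hrs
        gcongr
    have g0 : ∀ r, R ≤ r → g r = 0 := by
      intro r hr
      rw [g2 r (by linarith)]
      apply transition_of_ge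
      rw [le_div_iff₀ hR0, one_mul]
      exact hmono (mem_Ioi.2 (by linarith)) (mem_Ioi.2 (by linarith)) hr
    have gd1 : ∀ r, r ≤ b → deriv g r = 0 := by
      intro r hr
      have : g =ᶠ[𝓝 r] fun _ => 1 := by
        filter_upwards [gt_mem_nhds (show r < b + 1 by linarith)] with s hs using g1 s hs
      rw [this.deriv_eq, deriv_const]
    have gd2 : ∀ r, b < r → deriv g r = deriv transition (L r / L R) * (L' r / L R) := by
      intro r hr
      have : g =ᶠ[𝓝 r] fun r => transition (L r / L R) := by
        filter_upwards [lt_mem_nhds hr] with s hs using g2 s hs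
      rw [this.deriv_eq]
      have e1 : HasDerivAt transition (deriv transition (L r / L R)) (L r / L R) :=
        (contDiff_transition.differentiable (by simp)).differentiableAt.hasDerivAt
      exact (e1.comp r ((hLd r (hab.trans hr)).div_const (L R))).deriv
    have main := lintegral_ball_weight_le hu (ha.trans hab) gsm ganti
      (fun r hr => g1 r (by linarith)) g0
    set A : Set E3 := {x : E3 | a < ‖x‖ ∧ ‖x‖ < R ∧ L R / 2 < L ‖x‖} with hA
    refine main.trans ?_
    have hmul : ∀ f : E3 → ℝ≥0∞, ENNReal.ofReal C * (ENNReal.ofReal (1 / L R) * ∫⁻ x in A, f x) =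
        ∫⁻ x in A, ENNReal.ofReal C * (ENNReal.ofReal (1 / L R) * f x) := by
      intro f
      rw [lintegral_const_mul' _ _ ENNReal.ofReal_ne_top,
        lintegral_const_mul' _ _ ENNReal.ofReal_ne_top]
    rw [hmul]
    have hsub : Function.support (fun x : E3 =>
        ENNReal.ofReal (|deriv g ‖x‖| * ‖tangentialPart u x‖ ^ 2)) ⊆ A := by
      intro x hx
      have hne : deriv g ‖x‖ ≠ 0 := by
        intro h0
        simp [h0] at hx
      have hxb : b < ‖x‖ := lt_of_not_ge fun hh => hne (gd1 _ hh)
      rw [gd2 _ hxb] at hne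
      have hne' := left_ne_zero_of_mul hne
      have t1 : 1 / 2 < L ‖x‖ / L R := lt_of_not_ge fun hh => hne' (deriv_transition_of_le hh)
      have t2 : L ‖x‖ / L R < 1 := lt_of_not_ge fun hh => hne' (deriv_transition_of_ge hh)
      refine ⟨hab.trans hxb, lt_of_not_ge fun hRx => ?_, ?_⟩
      · rw [div_lt_one hR0] at t2
        exact absurd (hmono (mem_Ioi.2 (by linarith)) (mem_Ioi.2 (hab.trans hxb)) hRx)
          (not_le.2 t2)
      · rw [div_lt_div_iff₀ two_pos hR0] at t1
        linarith
    rw [← setLIntegral_eq_of_support_subset hsub]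
    refine lintegral_mono fun x => ?_
    have hl : 0 ≤ 1 / L R := by positivity
    rw [← ENNReal.ofReal_mul hl, ← ENNReal.ofReal_mul hC0]
    rcases le_or_gt ‖x‖ b with hx | hx
    · simp [gd1 _ hx]
    · refine ENNReal.ofReal_le_ofReal ?_
      rw [gd2 _ hx, abs_mul, abs_of_nonneg (div_nonneg (hLd0 _ (hab.trans hx)) hR0.le)]
      calc |deriv transition (L ‖x‖ / L R)| * (L' ‖x‖ / L R) * ‖tangentialPart u x‖ ^ 2
          ≤ C * (L' ‖x‖ / L R) * ‖tangentialPart u x‖ ^ 2 := by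
            have := div_nonneg (hLd0 _ (hab.trans hx)) hR0.le
            gcongr
            exact hC _
        _ = C * (1 / L R * (L' ‖x‖ * ‖tangentialPart u x‖ ^ 2)) := by ring
  have zero : ∀ b, a < b →
      ∫⁻ x in Metric.ball 0 b, ENNReal.ofReal (weight x ^ 3 * ‖u x‖ ^ 2) = 0 := by
    intro b hb
    -- The ball is fixed while `R` tends to infinity.
    have t := ENNReal.Tendsto.const_mul (a := ENNReal.ofReal C) h (Or.inr ENNReal.ofReal_ne_top)
    rw [mul_zero] at t
    exact le_antisymm (ge_of_tendsto t (step b hb)) zero_le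
  have hz : ∀ n : ℕ, ∀ᵐ x, x ∈ Metric.ball (0 : E3) (a + 1 + n) → u x = 0 := by
    intro n
    have hm : AEMeasurable (fun x => ENNReal.ofReal (weight x ^ 3 * ‖u x‖ ^ 2))
        (volume.restrict (Metric.ball 0 (a + 1 + n))) := by
      have h1 := hu.aestronglyMeasurable.norm.aemeasurable
      exact ((((contDiff_weight.continuous.pow 3).measurable.aemeasurable.mul
        (h1.pow_const 2)).ennreal_ofReal).restrict)
    have h2 := (lintegral_eq_zero_iff' hm).1 (zero (a + 1 + n)
      (by linarith [n.cast_nonneg (α := ℝ)]))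
    rw [← ae_restrict_iff' Metric.isOpen_ball.measurableSet]
    filter_upwards [h2] with x hx
    have h3 := weight_pos x
    simp only [Pi.zero_apply, ENNReal.ofReal_eq_zero] at hx
    have h4 : ‖u x‖ ^ 2 ≤ 0 := nonpos_of_mul_nonpos_right hx (by positivity)
    simpa using le_antisymm h4 (sq_nonneg _)
  filter_upwards [ae_all_iff.2 hz] with x hx
  obtain ⟨n, hn⟩ := exists_nat_gt ‖x‖
  exact hx n (by simp; linarith)

/-! ### The four decay conditions -/

lemma mem_annulus {r R : ℝ} {x : E3} : x ∈ annulus r R ↔ r < ‖x‖ ∧ ‖x‖ < R := by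
  simp [annulus, and_comm]

lemma measurableSet_annulus (r R : ℝ) : MeasurableSet (annulus r R) :=
  Metric.isOpen_ball.measurableSet.diff Metric.isClosed_closedBall.measurableSet

/-- A comparison of the weighted tangential energies on sets contained in annuli. -/
lemma tendsto_zero_of_le {c : ℝ} {A : ℝ → Set E3} {r : ℝ} {k : ℝ → ℝ}
    {f g : E3 → ℝ} (hA : ∀ R, A R ⊆ annulus r R)
    (hfg : ∀ x, r < ‖x‖ → f x ≤ c * g x) (hc : 0 ≤ c)
    (h : Tendsto (fun R => ENNReal.ofReal (k R) * ∫⁻ x in annulus r R, ENNReal.ofReal (g x))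
      atTop (𝓝 0)) :
    Tendsto (fun R => ENNReal.ofReal (k R) * ∫⁻ x in A R, ENNReal.ofReal (f x)) atTop (𝓝 0) := by
  have t := ENNReal.Tendsto.const_mul (a := ENNReal.ofReal c) h (Or.inr ENNReal.ofReal_ne_top)
  rw [mul_zero] at t
  refine tendsto_of_tendsto_of_tendsto_of_le_of_le tendsto_const_nhds t (fun _ => zero_le) ?_
  intro R
  calc ENNReal.ofReal (k R) * ∫⁻ x in A R, ENNReal.ofReal (f x)
      ≤ ENNReal.ofReal (k R) * ∫⁻ x in annulus r R, ENNReal.ofReal (f x) := by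
        gcongr
        exact hA R
    _ ≤ ENNReal.ofReal (k R) * ∫⁻ x in annulus r R, ENNReal.ofReal c * ENNReal.ofReal (g x) := by
        refine mul_le_mul' le_rfl ?_
        refine setLIntegral_mono' (measurableSet_annulus r R) fun x hx => ?_
        rw [← ENNReal.ofReal_mul hc]
        exact ENNReal.ofReal_le_ofReal (hfg x (mem_annulus.1 hx).1)
    _ = _ := by
        rw [lintegral_const_mul' _ _ ENNReal.ofReal_ne_top]
        ring

lemma one_lt_log {r : ℝ} (hr : Real.exp 1 < r) : 1 < Real.log r :=
  (Real.lt_log_iff_exp_lt ((Real.exp_pos 1).trans hr)).2 hr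

/-- A Beltrami flow vanishes if its tangential part is small in averages with the weight `1 / (|x| (log |x|)^β)`. -/
theorem ae_eq_zero_of_log_rpow_decay {u : E3 → E3} (hu : IsWeakBeltramiFlow u) {β : ℝ}
    (hβ : β < 1) (h : Tendsto (fun R : ℝ => ENNReal.ofReal (1 / Real.log R ^ (1 - β)) *
      ∫⁻ x in annulus (Real.exp 1) R,
        ENNReal.ofReal (‖tangentialPart u x‖ ^ 2 / (‖x‖ * Real.log ‖x‖ ^ β))) atTop (𝓝 0)) :
    u =ᵐ[volume] 0 := by
  have h1β : 0 < 1 - β := by linarith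
  refine ae_eq_zero_of_tendsto hu (Real.exp_pos 1) (L := fun r => Real.log r ^ (1 - β))
    (L' := fun r => (1 - β) * (1 / (r * Real.log r ^ β))) ?_ ?_ ?_ ?_ ?_
  · intro r hr
    have hr0 : r ≠ 0 := ((Real.exp_pos 1).trans hr).ne'
    have hl : Real.log r ≠ 0 := (zero_lt_one.trans (one_lt_log hr)).ne'
    exact ((Real.contDiffAt_log.2 hr0).rpow_const_of_ne hl).contDiffWithinAt
  · intro r hr
    have hr0 : r ≠ 0 := ((Real.exp_pos 1).trans hr).ne'
    have hl : 0 < Real.log r := zero_lt_one.trans (one_lt_log hr)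
    convert (Real.hasDerivAt_log hr0).rpow_const (p := 1 - β) (Or.inl hl.ne') using 1
    rw [show 1 - β - 1 = -β by ring, Real.rpow_neg hl.le]
    field_simp
  · intro r hr
    have hr0 : 0 < r := (Real.exp_pos 1).trans hr
    have hl : 0 < Real.log r := zero_lt_one.trans (one_lt_log hr)
    positivity
  · exact (tendsto_rpow_atTop h1β).comp Real.tendsto_log_atTop
  -- Here `L'` is `1 - β` times the given weight, so the comparison constant is `1 - β`.
  · refine tendsto_zero_of_le (fun R x hx => mem_annulus.2 ⟨hx.1, hx.2.1⟩)
      (fun x hx => le_of_eq ?_) h1β.le h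
    ring

/-- A Beltrami flow vanishes if its tangential part is small in averages with the weight `1 / |x|`. -/
theorem ae_eq_zero_of_log_decay {u : E3 → E3} (hu : IsWeakBeltramiFlow u)
    (h : Tendsto (fun R : ℝ => ENNReal.ofReal (1 / Real.log R) *
      ∫⁻ x in annulus 1 R, ENNReal.ofReal (‖tangentialPart u x‖ ^ 2 / ‖x‖)) atTop (𝓝 0)) :
    u =ᵐ[volume] 0 := by
  refine ae_eq_zero_of_tendsto hu one_pos (L := Real.log) (L' := fun r => r⁻¹) ?_ ?_ ?_
    Real.tendsto_log_atTop ?_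
  · exact fun r hr => (Real.contDiffAt_log.2 (zero_lt_one.trans hr).ne').contDiffWithinAt
  · exact fun r hr => Real.hasDerivAt_log (zero_lt_one.trans hr).ne'
  · exact fun r hr => inv_nonneg.2 (zero_le_one.trans hr.le)
  · refine tendsto_zero_of_le (fun R x hx => mem_annulus.2 ⟨hx.1, hx.2.1⟩)
      (fun x hx => le_of_eq ?_) zero_le_one h
    ring

/-- A Beltrami flow vanishes if its tangential part is small in averages with the weight `1 / (|x| log |x|)`. -/
theorem ae_eq_zero_of_log_log_decay {u : E3 → E3} (hu : IsWeakBeltramiFlow u)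
    (h : Tendsto (fun R : ℝ => ENNReal.ofReal (1 / Real.log (Real.log R)) *
      ∫⁻ x in annulus (Real.exp 1) R,
        ENNReal.ofReal (‖tangentialPart u x‖ ^ 2 / (‖x‖ * Real.log ‖x‖))) atTop (𝓝 0)) :
    u =ᵐ[volume] 0 := by
  refine ae_eq_zero_of_tendsto hu (Real.exp_pos 1) (L := fun r => Real.log (Real.log r))
    (L' := fun r => r⁻¹ / Real.log r) ?_ ?_ ?_
    (Real.tendsto_log_atTop.comp Real.tendsto_log_atTop) ?_
  · intro r hr
    have hr0 : r ≠ 0 := ((Real.exp_pos 1).trans hr).ne'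
    have hl : Real.log r ≠ 0 := (zero_lt_one.trans (one_lt_log hr)).ne'
    exact ((Real.contDiffAt_log.2 hr0).log hl).contDiffWithinAt
  · intro r hr
    have hr0 : r ≠ 0 := ((Real.exp_pos 1).trans hr).ne'
    have hl : Real.log r ≠ 0 := (zero_lt_one.trans (one_lt_log hr)).ne'
    exact (Real.hasDerivAt_log hr0).log hl
  · intro r hr
    have hr0 : 0 < r := (Real.exp_pos 1).trans hr
    have hl : 0 < Real.log r := zero_lt_one.trans (one_lt_log hr)
    positivity
  · refine tendsto_zero_of_le (fun R x hx => mem_annulus.2 ⟨hx.1, hx.2.1⟩)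
      (fun x hx => le_of_eq ?_) zero_le_one h
    ring

/-- Below the threshold `s` the first term suffices; above it `t^(2-p) ≤ s^(2-p)`, as `2 - p ≤ 0`.
With `s` free this takes the place of Hölder's inequality. -/
lemma sq_le_add_rpow {p t s : ℝ} (hp : 2 ≤ p) (ht : 0 ≤ t) (hs : 0 < s) :
    t ^ 2 ≤ s ^ 2 + s ^ (2 - p) * t ^ p := by
  rcases le_or_gt t s with h | h
  · have : 0 ≤ s ^ (2 - p) * t ^ p := by positivity
    nlinarith
  · have ht' : 0 < t := hs.trans h
    have h1 : t ^ (2 - p) ≤ s ^ (2 - p) :=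
      Real.rpow_le_rpow_of_nonpos hs h.le (by linarith)
    have h2 : t ^ 2 = t ^ (2 - p) * t ^ p := by
      rw [← Real.rpow_add ht', sub_add_cancel, Real.rpow_two]
    have h3 : t ^ (2 - p) * t ^ p ≤ s ^ (2 - p) * t ^ p := by gcongr
    nlinarith [sq_nonneg s]

/-- A Beltrami flow vanishes if its tangential part is small in `L^p` averages over dyadic annuli. -/
theorem ae_eq_zero_of_rpow_decay {u : E3 → E3} (hu : IsWeakBeltramiFlow u) {p : ℝ} (hp : 2 ≤ p)
    (h : Tendsto (fun R : ℝ => ENNReal.ofReal (1 / R ^ (3 - p)) *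
      ∫⁻ x in annulus R (2 * R), ENNReal.ofReal (‖tangentialPart u x‖ ^ p)) atTop (𝓝 0)) :
    u =ᵐ[volume] 0 := by
  refine ae_eq_zero_of_tendsto hu one_pos (L := id) (L' := fun _ => 1) contDiffOn_id
    (fun r _ => hasDerivAt_id r) (fun _ _ => zero_le_one) tendsto_id ?_
  set V : ℝ≥0∞ := volume (Metric.ball (0 : E3) 1) with hV
  have hVt : V ≠ ⊤ := measure_ball_lt_top.ne
  -- For `L = r` the cutoff varies only on `R/2 < |x| < R`, the dyadic annulus of radius `R/2`.
  have hhalf : Tendsto (fun R : ℝ => R / 2) atTop atTop := tendsto_id.atTop_div_const two_pos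
  have h' := h.comp hhalf
  have bound : ∀ δ : ℝ, 0 < δ → ∀ R : ℝ, 0 < R →
      ENNReal.ofReal (1 / R) * ∫⁻ x in {x : E3 | 1 < ‖x‖ ∧ ‖x‖ < R ∧ R / 2 < ‖x‖},
        ENNReal.ofReal (1 * ‖tangentialPart u x‖ ^ 2) ≤
      ENNReal.ofReal (δ ^ 2) * V + ENNReal.ofReal (δ ^ (2 - p) * (1 / 2) ^ (3 - p)) *
        (ENNReal.ofReal (1 / (R / 2) ^ (3 - p)) *
        ∫⁻ x in annulus (R / 2) (2 * (R / 2)), ENNReal.ofReal (‖tangentialPart u x‖ ^ p)) := by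
    intro δ hδ R hR
    -- The threshold `δ / R` is scale invariant: `R⁻¹ (δ/R)² R³ = δ²`, and `R⁻¹ (δ/R)^(2-p)` is a
    -- multiple of `R^(p-3)`.
    have hs : 0 < δ / R := by positivity
    have hsub : {x : E3 | 1 < ‖x‖ ∧ ‖x‖ < R ∧ R / 2 < ‖x‖} ⊆ annulus (R / 2) (2 * (R / 2)) :=
      fun x hx => mem_annulus.2 ⟨hx.2.2, by linarith [hx.2.1]⟩
    have hvol : volume (annulus (R / 2) (2 * (R / 2))) ≤ ENNReal.ofReal (R ^ 3) * V := by
      have : annulus (R / 2) (2 * (R / 2)) ⊆ Metric.ball 0 R := fun x hx => by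
        have := (mem_annulus.1 hx).2
        simp only [Metric.mem_ball, dist_zero_right]
        linarith
      refine (measure_mono this).trans (le_of_eq ?_)
      rw [Measure.addHaar_ball _ _ hR.le]
      simp [hV]
    calc ENNReal.ofReal (1 / R) * ∫⁻ x in {x : E3 | 1 < ‖x‖ ∧ ‖x‖ < R ∧ R / 2 < ‖x‖},
          ENNReal.ofReal (1 * ‖tangentialPart u x‖ ^ 2)
        ≤ ENNReal.ofReal (1 / R) * ∫⁻ x in annulus (R / 2) (2 * (R / 2)),
          (ENNReal.ofReal ((δ / R) ^ 2) + ENNReal.ofReal ((δ / R) ^ (2 - p)) *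
            ENNReal.ofReal (‖tangentialPart u x‖ ^ p)) := by
          refine mul_le_mul' le_rfl ?_
          refine (lintegral_mono_set hsub).trans (lintegral_mono fun x => ?_)
          rw [← ENNReal.ofReal_mul (by positivity), ← ENNReal.ofReal_add (by positivity)
            (by positivity), one_mul]
          exact ENNReal.ofReal_le_ofReal (sq_le_add_rpow hp (norm_nonneg _) hs)
      _ = ENNReal.ofReal (1 / R) * (ENNReal.ofReal ((δ / R) ^ 2) *
          volume (annulus (R / 2) (2 * (R / 2))) + ENNReal.ofReal ((δ / R) ^ (2 - p)) *
          ∫⁻ x in annulus (R / 2) (2 * (R / 2)), ENNReal.ofReal (‖tangentialPart u x‖ ^ p)) := by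
          rw [lintegral_add_left' aemeasurable_const, setLIntegral_const,
            lintegral_const_mul' _ _ ENNReal.ofReal_ne_top]
      _ ≤ ENNReal.ofReal (1 / R) * (ENNReal.ofReal ((δ / R) ^ 2) *
          (ENNReal.ofReal (R ^ 3) * V) + ENNReal.ofReal ((δ / R) ^ (2 - p)) *
          ∫⁻ x in annulus (R / 2) (2 * (R / 2)), ENNReal.ofReal (‖tangentialPart u x‖ ^ p)) := by
          gcongr
      _ = _ := by
          have e1 : (1 / R) * ((δ / R) ^ 2 * R ^ 3) = δ ^ 2 := by field_simp
          have e2 : (1 / R) * (δ / R) ^ (2 - p) =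
              δ ^ (2 - p) * (1 / 2) ^ (3 - p) * (1 / (R / 2) ^ (3 - p)) := by
            rw [Real.div_rpow hδ.le hR.le, Real.div_rpow hR.le zero_le_two,
              Real.div_rpow zero_le_one zero_le_two, Real.one_rpow,
              show 3 - p = 1 + (2 - p) by ring, Real.rpow_add hR, Real.rpow_one]
            have := (Real.rpow_pos_of_pos hR (2 - p)).ne'
            have := (Real.rpow_pos_of_pos two_pos (1 + (2 - p))).ne'
            field_simp
          rw [← mul_assoc (ENNReal.ofReal (δ ^ (2 - p) * _)), ← ENNReal.ofReal_mul (by positivity),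
            ← e1, ← e2, ENNReal.ofReal_mul (by positivity), ENNReal.ofReal_mul (by positivity),
            ENNReal.ofReal_mul (by positivity)]
          ring
  rw [ENNReal.tendsto_nhds_zero]
  intro ε hε
  have t1 : Tendsto (fun δ : ℝ => ENNReal.ofReal (δ ^ 2) * V) (𝓝[>] 0)
      (𝓝 (ENNReal.ofReal (0 ^ 2) * V)) :=
    ENNReal.Tendsto.mul_const (((ENNReal.continuous_ofReal.comp (continuous_pow 2)).tendsto
      0).mono_left nhdsWithin_le_nhds) (Or.inr hVt)
  rw [zero_pow two_ne_zero, ENNReal.ofReal_zero, zero_mul] at t1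
  have hε2 : 0 < ε / 2 := ENNReal.half_pos hε.ne'
  -- `δ` is fixed before `R`, because the factor `δ^(2-p)` may blow up as `δ` tends to zero.
  obtain ⟨δ, hδ, hδ0⟩ := ((t1.eventually (gt_mem_nhds hε2)).and self_mem_nhdsWithin).exists
  have t2 := ENNReal.Tendsto.const_mul (a := ENNReal.ofReal (δ ^ (2 - p) * (1 / 2) ^ (3 - p))) h'
    (Or.inr ENNReal.ofReal_ne_top)
  rw [mul_zero] at t2
  filter_upwards [ENNReal.tendsto_nhds_zero.1 t2 _ hε2, eventually_gt_atTop 0] with R hR hR0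
  calc _ ≤ _ := bound δ hδ0 R hR0
    _ ≤ ε / 2 + ε / 2 := add_le_add hδ.le hR
    _ = ε := ENNReal.add_halves ε

end Beltrami

theorem theorem1 (u : Beltrami.E3 → Beltrami.E3) (hu : Beltrami.IsWeakBeltramiFlow u)
    (hdecay :
      (∃ p : ℝ, 2 ≤ p ∧ p ≤ 3 ∧
        Tendsto (fun R : ℝ => ENNReal.ofReal (1 / R ^ (3 - p)) *
          ∫⁻ x in Beltrami.annulus R (2 * R),
            ENNReal.ofReal (‖Beltrami.tangentialPart u x‖ ^ p)) atTop (𝓝 0)) ∨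
      Tendsto (fun R : ℝ => ENNReal.ofReal (1 / Real.log R) *
          ∫⁻ x in Beltrami.annulus 1 R,
            ENNReal.ofReal (‖Beltrami.tangentialPart u x‖ ^ 2 / ‖x‖)) atTop (𝓝 0) ∨
      (∃ β : ℝ, β < 1 ∧
        Tendsto (fun R : ℝ => ENNReal.ofReal (1 / Real.log R ^ (1 - β)) *
          ∫⁻ x in Beltrami.annulus (Real.exp 1) R,
            ENNReal.ofReal (‖Beltrami.tangentialPart u x‖ ^ 2 / (‖x‖ * Real.log ‖x‖ ^ β)))
          atTop (𝓝 0)) ∨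
      Tendsto (fun R : ℝ => ENNReal.ofReal (1 / Real.log (Real.log R)) *
          ∫⁻ x in Beltrami.annulus (Real.exp 1) R,
            ENNReal.ofReal (‖Beltrami.tangentialPart u x‖ ^ 2 / (‖x‖ * Real.log ‖x‖)))
          atTop (𝓝 0)) :
    u =ᵐ[volume] 0 := by
  rcases hdecay with ⟨p, hp, -, h⟩ | h | ⟨β, hβ, h⟩ | h
  · exact Beltrami.ae_eq_zero_of_rpow_decay hu hp h
  · exact Beltrami.ae_eq_zero_of_log_decay hu h
  · exact Beltrami.ae_eq_zero_of_log_rpow_decay hu hβ h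
  · exact Beltrami.ae_eq_zero_of_log_log_decay hu h
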